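/- For a finite set $P\subset\mathbb{R}^d$ with at least two points, where $\mathbb{R}^d$ carries the sup-metric $\rho(x,y)=\max_j|x[j]-y[j]|$, put $r_v=\min\{\rho(u,v):u\in P\setminus\{v\}\}$ and $B_v=\{u\in\mathbb{R}^d:\rho(u,v)<r_v\}$ for $v\in P$. The sphere-of-influence graph of $P$ is the simple graph with vertex set $P$ in which distinct $u,v\in P$ are adjacent if and only if $B_u\cap B_v\neq\emptyset$. A graph $G$ is realizable in $\mathbb{R}^d$ if it is isomorphic to the sphere-of-influence graph of some finite set $P\subset\mathbb{R}^d$ with at least two points, and $SIG(G)$ denotes the least $d$ such that $G$ is realizable in $\mathbb{R}^d$. Theorem. Let $G$ be a finite simple graph of order $n\ge 1$ with no isolated vertices. Then $G$ is realizable in $\mathbb{R}^d$ for some $d\le\lfloor 2n/3\rfloor+2$, so that $SIG(G)$ is well defined and $$SIG(G)\le\left\lfloor\frac{2n}{3}\right\rfloor+2.$$ In particular, if $n$ is not a multiple of $3$, then $$SIG(G)\le\left\lceil\frac{2n}{3}\right\rceil+1.$$ -/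

import Mathlib

noncomputable section

/-- The distance `r_v` from `v` to its nearest neighbour in `P`, in the sup-metric of `ℝ^d`
(the metric which `Fin d → ℝ` carries in Mathlib). If `P` is finite and has a point other
than `v`, the infimum is attained. -/
def nearestDist {d : ℕ} (P : Finset (Fin d → ℝ)) (v : Fin d → ℝ) : ℝ :=
  Metric.infDist v ((P : Set (Fin d → ℝ)) \ {v})

/-- The sphere of influence at `v`: the open sup-metric ball about `v` of radius `r_v`. -/
def sphereOfInfluence {d : ℕ} (P : Finset (Fin d → ℝ)) (v : Fin d → ℝ) : Set (Fin d → ℝ) :=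
  Metric.ball v (nearestDist P v)

/-- The sphere of influence graph of `P`: its vertices are the points of `P`, and two distinct
points are adjacent when their spheres of influence intersect. -/
def sphereOfInfluenceGraph {d : ℕ} (P : Finset (Fin d → ℝ)) : SimpleGraph P where
  Adj u v := u ≠ v ∧ (sphereOfInfluence P u ∩ sphereOfInfluence P v).Nonempty
  symm := ⟨fun _ _ h => ⟨h.1.symm, by rw [Set.inter_comm]; exact h.2⟩⟩
  loopless := ⟨fun _ h => h.1 rfl⟩

/-- `G` is realizable in `ℝ^d`: it is isomorphic to the sphere of influence graph of a finite
set of at least two points of `ℝ^d` with the sup-metric. -/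
def SIGRealizable {V : Type*} (G : SimpleGraph V) (d : ℕ) : Prop :=
  ∃ P : Finset (Fin d → ℝ), 2 ≤ P.card ∧ Nonempty (G ≃g sphereOfInfluenceGraph P)

/-- The SIG-dimension of `G`: the least `d` such that `G` is realizable in `ℝ^d`
(with the value `0` if there is no such `d`). -/
def sigDim {V : Type*} (G : SimpleGraph V) : ℕ :=
  sInf {d : ℕ | SIGRealizable G d}

end

/-- A function usable as one coordinate of a realization with radii `r`, where the edges of `E`
are to become nearest-neighbour pairs. -/
def IsCoord {V : Type*} (G E : SimpleGraph V) (r : V → ℝ) (f : V → ℝ) : Prop :=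
  (∀ u v, G.Adj u v → |f u - f v| < r u + r v) ∧ ∀ u v, E.Adj u v → |f u - f v| ≤ r u

/-- Some `k` coordinates separate all non-adjacent pairs inside `U`, and keep all vertices of `U`
far enough from all their neighbours. -/
def Resolved {V : Type*} (G E : SimpleGraph V) (r : V → ℝ) (U : Set V) (k : ℕ) : Prop :=
  ∃ F : List (V → ℝ), F.length = k ∧ (∀ f ∈ F, IsCoord G E r f) ∧
    (∀ u ∈ U, ∀ v ∈ U, u ≠ v → ¬ G.Adj u v → ∃ f ∈ F, r u + r v ≤ |f u - f v|) ∧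
    ∀ u ∈ U, ∀ v, G.Adj u v → ∃ f ∈ F, max (r u) (r v) ≤ |f u - f v|

theorem Resolved.realizable {V : Type*} [Fintype V] [Nontrivial V] {G E : SimpleGraph V}
    {r : V → ℝ} {k : ℕ} (hr : ∀ v, 0 < r v) (hE' : ∀ v, ∃ u, E.Adj v u)
    (h : Resolved G E r Set.univ k) : SIGRealizable G k := by
  classical
  obtain ⟨F, rfl, hF, hsep, hfar⟩ := h
  let φ : V → (Fin F.length → ℝ) := fun v i => F[i] v
  have hcoord : ∀ u v (f : V → ℝ), f ∈ F → |f u - f v| ≤ dist (φ u) (φ v) := by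
    intro u v f hf
    obtain ⟨i, hi, rfl⟩ := List.getElem_of_mem hf
    have := dist_le_pi_dist (φ u) (φ v) ⟨i, hi⟩
    simpa [φ, Real.dist_eq] using this
  have hd_far : ∀ u v, G.Adj u v → max (r u) (r v) ≤ dist (φ u) (φ v) := by
    intro u v huv
    obtain ⟨f, hf, h⟩ := hfar u trivial v huv
    exact h.trans (hcoord u v f hf)
  have hd_sep : ∀ u v, u ≠ v → ¬ G.Adj u v → r u + r v ≤ dist (φ u) (φ v) := by
    intro u v hne huv
    obtain ⟨f, hf, h⟩ := hsep u trivial v trivial hne huv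
    exact h.trans (hcoord u v f hf)
  have hd_near : ∀ u v, G.Adj u v → dist (φ u) (φ v) < r u + r v := by
    intro u v huv
    rw [dist_pi_lt_iff (add_pos (hr u) (hr v))]
    intro i
    rw [Real.dist_eq]
    exact (hF _ (List.getElem_mem i.2)).1 u v huv
  have hd_E : ∀ u v, E.Adj u v → dist (φ u) (φ v) ≤ r u := by
    intro u v huv
    rw [dist_pi_le_iff (hr u).le]
    intro i
    rw [Real.dist_eq]
    exact (hF _ (List.getElem_mem i.2)).2 u v huv
  have hd_ge : ∀ u v, u ≠ v → r u ≤ dist (φ u) (φ v) := by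
    intro u v hne
    by_cases huv : G.Adj u v
    · exact (le_max_left _ _).trans (hd_far u v huv)
    · linarith [hd_sep u v hne huv, hr v]
  have hinj : Function.Injective φ := by
    intro u v huv
    by_contra hne
    have := hd_ge u v hne
    rw [huv, dist_self] at this
    linarith [hr u]
  let P : Finset (Fin F.length → ℝ) := Finset.univ.image φ
  have hmem : ∀ v, φ v ∈ P := fun v => Finset.mem_image_of_mem _ (Finset.mem_univ v)
  have hnear : ∀ v, nearestDist P (φ v) = r v := by
    intro v
    obtain ⟨u, hu⟩ := hE' v
    have hne : v ≠ u := hu.ne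
    have hmu : φ u ∈ (P : Set (Fin F.length → ℝ)) \ {φ v} :=
      ⟨hmem u, fun h => hne (hinj h).symm⟩
    apply le_antisymm
    · exact (Metric.infDist_le_dist_of_mem hmu).trans (hd_E v u hu)
    · refine (Metric.le_infDist ⟨_, hmu⟩).2 ?_
      rintro p ⟨hp, hpv⟩
      obtain ⟨w, -, rfl⟩ := Finset.mem_image.1 (Finset.mem_coe.1 hp)
      exact hd_ge v w fun h => hpv (by rw [h]; rfl)
  refine ⟨P, ?_, ⟨?_⟩⟩
  · rw [Finset.card_image_of_injective _ hinj, Finset.card_univ]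
    exact Fintype.one_lt_card
  · let e : V ≃ P := Equiv.ofBijective (fun v => ⟨φ v, hmem v⟩)
      ⟨fun u v h => hinj (Subtype.ext_iff.1 h), by
        rintro ⟨p, hp⟩
        obtain ⟨w, -, rfl⟩ := Finset.mem_image.1 hp
        exact ⟨w, rfl⟩⟩
    refine ⟨e, ?_⟩
    intro u v
    change (e u ≠ e v ∧ (Metric.ball (φ u) (nearestDist P (φ u)) ∩
      Metric.ball (φ v) (nearestDist P (φ v))).Nonempty) ↔ G.Adj u v
    rw [hnear, hnear, ← Set.not_disjoint_iff_nonempty_inter,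
      disjoint_ball_ball_iff (hr u) (hr v), e.injective.ne_iff, not_le]
    constructor
    · rintro ⟨hne, hlt⟩
      by_contra huv
      exact absurd (hd_sep u v hne huv) (not_le.2 hlt)
    · exact fun huv => ⟨huv.ne, hd_near u v huv⟩

theorem Resolved.single {V : Type*} {G E : SimpleGraph V} {r : V → ℝ} {U U' : Set V} {k : ℕ}
    (hr1 : ∀ v, 1 ≤ r v) (hrE : ∀ u v, E.Adj u v → r u = r v) (hEG : E ≤ G)
    (x : V) (hU : ∀ v ∈ U, v ∈ U' ∨ v = x) (h : Resolved G E r U' k) :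
    Resolved G E r U (k + 1) := by
  classical
  obtain ⟨F, rfl, hF, hsep, hfar⟩ := h
  let f : V → ℝ := fun z => if z = x then 0 else if G.Adj x z then max (r x) (r z) else r x + r z
  have fx : f x = 0 := by simp [f]
  have fa : ∀ z, G.Adj x z → f z = max (r x) (r z) := fun z h => by simp [f, h, h.ne']
  have fn : ∀ z, z ≠ x → ¬ G.Adj x z → f z = r x + r z := fun z h h' => by simp [f, h, h']
  have bound : ∀ z, z ≠ x → r x ≤ f z ∧ f z ≤ r x + r z := by
    intro z hz
    have := hr1 x; have := hr1 z
    by_cases h : G.Adj x z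
    · rw [fa z h]
      exact ⟨le_max_left _ _, max_le (by linarith) (by linarith)⟩
    · rw [fn z hz h]; constructor <;> linarith
  have hf : IsCoord G E r f := by
    constructor
    · intro u v huv
      have := hr1 x; have hu := hr1 u; have hv := hr1 v
      by_cases hux : u = x
      · subst hux
        rw [fx, fa v huv, zero_sub, abs_neg, abs_of_nonneg (le_trans (by linarith) (le_max_left _ _))]
        exact max_lt (by linarith) (by linarith)
      by_cases hvx : v = x
      · subst hvx
        rw [fx, fa u huv.symm, sub_zero, abs_of_nonneg (le_trans (by linarith) (le_max_left _ _))]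
        exact max_lt (by linarith) (by linarith)
      have := bound u hux; have := bound v hvx
      rw [abs_lt]; constructor <;> linarith
    · intro u v huv
      have := hr1 x; have hu := hr1 u; have hv := hr1 v; have e := hrE u v huv
      by_cases hux : u = x
      · subst hux
        rw [fx, fa v (hEG huv), zero_sub, abs_neg, ← e, max_self, abs_of_nonneg (by linarith)]
      by_cases hvx : v = x
      · subst hvx
        rw [fx, fa u (hEG huv).symm, sub_zero, e, max_self, abs_of_nonneg (by linarith)]
      have := bound u hux; have := bound v hvx
      rw [abs_le]; constructor <;> linarith
  have sepx : ∀ z, z ≠ x → ¬ G.Adj x z → r x + r z ≤ |f x - f z| := by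
    intro z hz h
    have := hr1 x; have := hr1 z
    rw [fx, fn z hz h, zero_sub, abs_neg, abs_of_nonneg (by linarith)]
  have farx : ∀ z, G.Adj x z → max (r x) (r z) ≤ |f x - f z| := by
    intro z h
    have := hr1 x
    rw [fx, fa z h, zero_sub, abs_neg]
    exact le_abs_self _
  refine ⟨f :: F, by simp, ?_, ?_, ?_⟩
  · simpa using ⟨hf, hF⟩
  · intro u hu v hv hne huv
    by_cases hux : u = x
    · subst hux
      exact ⟨f, by simp, sepx v hne.symm huv⟩
    by_cases hvx : v = x
    · subst hvx
      refine ⟨f, by simp, ?_⟩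
      rw [abs_sub_comm, add_comm]
      exact sepx u hne fun h => huv h.symm
    obtain ⟨g, hg, h⟩ := hsep u ((hU u hu).resolve_right hux) v ((hU v hv).resolve_right hvx) hne huv
    exact ⟨g, by simp [hg], h⟩
  · intro u hu v huv
    rcases hU u hu with h | rfl
    · obtain ⟨g, hg, h⟩ := hfar u h v huv
      exact ⟨g, by simp [hg], h⟩
    · exact ⟨f, by simp, farx v huv⟩

/-- Radii in `[1, 11/10]`, constant along the edges of the subgraph `E` of `G`. -/
structure IsRadii {V : Type*} (G E : SimpleGraph V) (r : V → ℝ) : Prop where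
  one_le : ∀ v, 1 ≤ r v
  le : ∀ v, r v ≤ 11 / 10
  eq_of_adj : ∀ {u v}, E.Adj u v → r u = r v
  sub : ∀ {u v}, E.Adj u v → G.Adj u v

/-- The basic coordinate: it separates `x` from `X`, `w` from `W`, and both `w` and `y`
from `A`. The case `y = w` is allowed. -/
theorem IsRadii.exists_coord {V : Type*} {G E : SimpleGraph V} {r : V → ℝ} (hR : IsRadii G E r)
    {x w y : V} {X W A : Set V} {β β' : ℝ}
    (hxw : ¬ G.Adj x w) (hxy : ¬ G.Adj x y) (hwy : ¬ G.Adj w y) (nxw : x ≠ w) (nxy : x ≠ y)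
    (hX : ∀ z ∈ X, ¬ G.Adj x z) (hW : ∀ z ∈ W, ¬ G.Adj w z)
    (hA : ∀ z ∈ A, ¬ G.Adj w z ∧ ¬ G.Adj y z)
    (mx : x ∉ X ∧ x ∉ W ∧ x ∉ A) (mw : w ∉ X ∧ w ∉ W ∧ w ∉ A) (my : y ∉ X ∧ y ∉ W ∧ y ∉ A)
    (dXW : ∀ z ∈ X, z ∉ W) (dXA : ∀ z ∈ X, z ∉ A) (dWA : ∀ z ∈ W, z ∉ A)
    (h9 : 9 / 10 ≤ β') (hββ : β' ≤ β) (hβx : β ≤ r x) (hβw : β < r w) (hβy : β' ≤ r y)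
    (hyw : y = w → β' = β)
    (hWy : ∀ z ∈ W, G.Adj y z → β' < β)
    (hEx : ∀ v, E.Adj x v → v ∈ W ∨ v ∈ A ∨ β < r x)
    (hEy : ∀ v, E.Adj y v → v ∉ W ∧ (v ∈ X ∨ β' < r y))
    (dExw : ∀ v, E.Adj x v → ¬ E.Adj w v) (dExy : ∀ v, E.Adj x v → ¬ E.Adj y v)
    (dEwy : ∀ v, E.Adj w v → E.Adj y v → y = w)
    (hEwA : ∀ v z, E.Adj w v → E.Adj v z → z ∉ A)
    (cWX : ∀ a ∈ W, ∀ b ∈ X, E.Adj a b → r a ≤ β)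
    (cAX : ∀ a ∈ A, ∀ b ∈ X, E.Adj a b → r a ≤ β') :
    ∃ f : V → ℝ, IsCoord G E r f ∧
      (∀ z ∈ X, r x + r z ≤ |f x - f z|) ∧ (∀ z ∈ W, r w + r z ≤ |f w - f z|) ∧
      (∀ z ∈ A, r w + r z ≤ |f w - f z| ∧ r y + r z ≤ |f y - f z|) ∧
      r x + r w ≤ |f x - f w| ∧ r x + r y ≤ |f x - f y| ∧
      (∀ v, v ∉ X → v ∉ W → v ∉ A → v ≠ x → v ≠ w → v ≠ y → max (r x) (r v) ≤ |f x - f v|) ∧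
      (∀ v, v ∉ X → v ∉ W → v ∉ A → v ≠ x → v ≠ w → v ≠ y → (¬ E.Adj y v ∨ y = w) →
        max (r w) (r v) ≤ |f w - f v|) := by
  classical
  have spec : ∃ f : V → ℝ, f x = 0 ∧ f w = r x + r w + β ∧ f y = r x + r y + β' ∧
      (∀ z ∈ X, f z = r x + r z) ∧ (∀ z ∈ W, f z = r x + β - r z) ∧
      (∀ z ∈ A, f z = r x + β' - r z) ∧
      (∀ z, z ∉ X → z ∉ W → z ∉ A → z ≠ x → z ≠ w → z ≠ y →
        (E.Adj x z ∧ f z = r x) ∨ (E.Adj w z ∧ f z = r x + β) ∨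
        (E.Adj y z ∧ f z = r x + β') ∨
        (¬ E.Adj x z ∧ ¬ E.Adj w z ∧ ¬ E.Adj y z ∧ f z = r x + 1 / 2)) := by
    refine ⟨fun z => if z = x then 0 else if z = w then r x + r w + β else
      if z = y then r x + r y + β' else if z ∈ X then r x + r z else
      if z ∈ W then r x + β - r z else if z ∈ A then r x + β' - r z else
      if E.Adj x z then r x else if E.Adj w z then r x + β else
      if E.Adj y z then r x + β' else r x + 1 / 2, by simp, by simp [nxw.symm], ?_, ?_, ?_, ?_, ?_⟩
    · by_cases h : y = w
      · simp [h, nxw.symm, hyw h]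
      · simp [h, nxy.symm]
    · intro z hz
      have h1 : z ≠ x := fun h => mx.1 (h ▸ hz)
      have h2 : z ≠ w := fun h => mw.1 (h ▸ hz)
      have h3 : z ≠ y := fun h => my.1 (h ▸ hz)
      simp [h1, h2, h3, hz]
    · intro z hz
      have h1 : z ≠ x := fun h => mx.2.1 (h ▸ hz)
      have h2 : z ≠ w := fun h => mw.2.1 (h ▸ hz)
      have h3 : z ≠ y := fun h => my.2.1 (h ▸ hz)
      have h4 : z ∉ X := fun h => dXW z h hz
      simp [h1, h2, h3, h4, hz]
    · intro z hz
      have h1 : z ≠ x := fun h => mx.2.2 (h ▸ hz)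
      have h2 : z ≠ w := fun h => mw.2.2 (h ▸ hz)
      have h3 : z ≠ y := fun h => my.2.2 (h ▸ hz)
      have h4 : z ∉ X := fun h => dXA z h hz
      have h5 : z ∉ W := fun h => dWA z h hz
      simp [h1, h2, h3, h4, h5, hz]
    · intro z h1 h2 h3 h4 h5 h6
      by_cases e1 : E.Adj x z
      · left; simp [h1, h2, h3, h4, h5, h6, e1]
      by_cases e2 : E.Adj w z
      · right; left; simp [h1, h2, h3, h4, h5, h6, e1, e2]
      by_cases e3 : E.Adj y z
      · right; right; left; simp [h1, h2, h3, h4, h5, h6, e1, e2, e3]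
      · right; right; right; simp [h1, h2, h3, h4, h5, h6, e1, e2, e3]
  obtain ⟨f, fx, fw, fy, fX, fW, fA, fO⟩ := spec
  have cls : ∀ z, z ≠ x → z ≠ w → z ≠ y → z ∈ X ∨ z ∈ W ∨ z ∈ A ∨
      (z ∉ X ∧ z ∉ W ∧ z ∉ A) := fun z _ _ _ => by tauto
  have rx1 := hR.one_le x; have rx2 := hR.le x
  have rw1 := hR.one_le w; have rw2 := hR.le w
  have ry1 := hR.one_le y; have ry2 := hR.le y
  have c1x : ∀ v, G.Adj x v → |f x - f v| < r x + r v := by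
    intro v h
    have := hR.one_le v; have := hR.le v
    have n1 : v ≠ x := h.ne'
    have n2 : v ≠ w := fun e => hxw (e ▸ h)
    have n3 : v ≠ y := fun e => hxy (e ▸ h)
    rw [fx, abs_lt]
    rcases cls v n1 n2 n3 with hv | hv | hv | ⟨a1, a2, a3⟩
    · exact absurd h (hX v hv)
    · rw [fW v hv]; constructor <;> linarith
    · rw [fA v hv]; constructor <;> linarith
    · rcases fO v a1 a2 a3 n1 n2 n3 with ⟨e, q⟩ | ⟨e, q⟩ | ⟨e, q⟩ | ⟨-, -, -, q⟩
      · rw [q]; constructor <;> linarith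
      · have := hR.eq_of_adj e
        rw [q]; constructor <;> linarith
      · have := hR.eq_of_adj e
        have := ((hEy v e).2.resolve_left a1)
        rw [q]; constructor <;> linarith
      · rw [q]; constructor <;> linarith
  have c1w : ∀ v, G.Adj w v → |f w - f v| < r w + r v := by
    intro v h
    have := hR.one_le v; have := hR.le v
    have n1 : v ≠ x := fun e => hxw (e ▸ h.symm)
    have n2 : v ≠ w := h.ne'
    have n3 : v ≠ y := fun e => hwy (e ▸ h)
    rw [fw, abs_lt]
    rcases cls v n1 n2 n3 with hv | hv | hv | ⟨a1, a2, a3⟩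
    · rw [fX v hv]; constructor <;> linarith
    · exact absurd h (hW v hv)
    · exact absurd h (hA v hv).1
    · rcases fO v a1 a2 a3 n1 n2 n3 with ⟨e, q⟩ | ⟨e, q⟩ | ⟨e, q⟩ | ⟨-, -, -, q⟩
      · have := hR.eq_of_adj e
        have : β < r x := by
          rcases hEx v e with h | h | h
          · exact absurd h a2
          · exact absurd h a3
          · exact h
        rw [q]; constructor <;> linarith
      · rw [q]; constructor <;> linarith
      · rw [q]; constructor <;> linarith
      · rw [q]; constructor <;> linarith
  have c1y : ∀ v, G.Adj y v → |f y - f v| < r y + r v := by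
    intro v h
    have := hR.one_le v; have := hR.le v
    have n1 : v ≠ x := fun e => hxy (e ▸ h.symm)
    have n2 : v ≠ w := fun e => hwy (e ▸ h.symm)
    have n3 : v ≠ y := h.ne'
    rw [fy, abs_lt]
    rcases cls v n1 n2 n3 with hv | hv | hv | ⟨a1, a2, a3⟩
    · rw [fX v hv]; constructor <;> linarith
    · have := hWy v hv h
      rw [fW v hv]; constructor <;> linarith
    · exact absurd h (hA v hv).2
    · rcases fO v a1 a2 a3 n1 n2 n3 with ⟨e, q⟩ | ⟨e, q⟩ | ⟨e, q⟩ | ⟨-, -, -, q⟩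
      · have := hR.eq_of_adj e
        have : β < r x := by
          rcases hEx v e with h | h | h
          · exact absurd h a2
          · exact absurd h a3
          · exact h
        rw [q]; constructor <;> linarith
      · rw [q]; constructor <;> linarith
      · rw [q]; constructor <;> linarith
      · rw [q]; constructor <;> linarith
  have range : ∀ z, z ≠ x → z ≠ w → z ≠ y → r x - 1 / 5 ≤ f z ∧ f z ≤ r x + 11 / 10 := by
    intro z n1 n2 n3
    have := hR.one_le z; have := hR.le z
    rcases cls z n1 n2 n3 with hv | hv | hv | ⟨a1, a2, a3⟩
    · rw [fX z hv]; constructor <;> linarith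
    · rw [fW z hv]; constructor <;> linarith
    · rw [fA z hv]; constructor <;> linarith
    · rcases fO z a1 a2 a3 n1 n2 n3 with ⟨e, q⟩ | ⟨e, q⟩ | ⟨e, q⟩ | ⟨-, -, -, q⟩ <;>
        rw [q] <;> constructor <;> linarith
  have c2x : ∀ v, E.Adj x v → |f x - f v| ≤ r x := by
    intro v e
    have := hR.one_le v; have := hR.le v
    have h := hR.sub e
    have er := hR.eq_of_adj e
    have n1 : v ≠ x := h.ne'
    have n2 : v ≠ w := fun e => hxw (e ▸ h)
    have n3 : v ≠ y := fun e => hxy (e ▸ h)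
    rw [fx, abs_le]
    rcases cls v n1 n2 n3 with hv | hv | hv | ⟨a1, a2, a3⟩
    · exact absurd h (hX v hv)
    · rw [fW v hv]; constructor <;> linarith
    · rw [fA v hv]; constructor <;> linarith
    · rcases fO v a1 a2 a3 n1 n2 n3 with ⟨e', q⟩ | ⟨e', q⟩ | ⟨e', q⟩ | ⟨q1, -, -, q⟩
      · rw [q]; constructor <;> linarith
      · exact absurd e' (dExw v e)
      · exact absurd e' (dExy v e)
      · exact absurd e q1
  have c2w : ∀ v, E.Adj w v → |f w - f v| ≤ r w := by
    intro v e
    have := hR.one_le v; have := hR.le v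
    have h := hR.sub e
    have er := hR.eq_of_adj e
    have n1 : v ≠ x := fun e => hxw (e ▸ h.symm)
    have n2 : v ≠ w := h.ne'
    have n3 : v ≠ y := fun e => hwy (e ▸ h)
    rw [fw, abs_le]
    rcases cls v n1 n2 n3 with hv | hv | hv | ⟨a1, a2, a3⟩
    · rw [fX v hv]; constructor <;> linarith
    · exact absurd h (hW v hv)
    · exact absurd h (hA v hv).1
    · rcases fO v a1 a2 a3 n1 n2 n3 with ⟨e', q⟩ | ⟨e', q⟩ | ⟨e', q⟩ | ⟨-, q1, -, q⟩
      · exact absurd e (dExw v e')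
      · rw [q]; constructor <;> linarith
      · have := hyw (dEwy v e e')
        rw [q]; constructor <;> linarith
      · exact absurd e q1
  have c2y : ∀ v, y ≠ w → E.Adj y v → |f y - f v| ≤ r y := by
    intro v nyw e
    have := hR.one_le v; have := hR.le v
    have h := hR.sub e
    have er := hR.eq_of_adj e
    have n1 : v ≠ x := fun e => hxy (e ▸ h.symm)
    have n2 : v ≠ w := fun e => hwy (e ▸ h.symm)
    have n3 : v ≠ y := h.ne'
    rw [fy, abs_le]
    rcases cls v n1 n2 n3 with hv | hv | hv | ⟨a1, a2, a3⟩
    · rw [fX v hv]; constructor <;> linarith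
    · exact absurd hv (hEy v e).1
    · exact absurd h (hA v hv).2
    · rcases fO v a1 a2 a3 n1 n2 n3 with ⟨e', q⟩ | ⟨e', q⟩ | ⟨e', q⟩ | ⟨-, -, q1, q⟩
      · exact absurd e (dExy v e')
      · exact absurd (dEwy v e' e) nyw
      · rw [q]; constructor <;> linarith
      · exact absurd e q1
  have c2 : ∀ a b, a ≠ x → a ≠ w → a ≠ y → b ≠ x → b ≠ w → b ≠ y → E.Adj a b →
      f b - f a ≤ r a := by
    intro a b n1 n2 n3 n1' n2' n3' e
    have := hR.one_le a; have := hR.le a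
    have er := hR.eq_of_adj e
    have hb : f b ≤ r x + r b := by
      rcases cls b n1' n2' n3' with hv | hv | hv | ⟨a1, a2, a3⟩
      · rw [fX b hv]
      · rw [fW b hv]; linarith
      · rw [fA b hv]; linarith
      · rcases fO b a1 a2 a3 n1' n2' n3' with ⟨e', q⟩ | ⟨e', q⟩ | ⟨e', q⟩ | ⟨-, -, -, q⟩ <;> rw [q]
        · linarith
        · have := hR.eq_of_adj e'; linarith
        · have := hR.eq_of_adj e'; linarith
        · linarith
    rcases cls a n1 n2 n3 with ha | ha | ha | ⟨a1, a2, a3⟩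
    · rw [fX a ha]; linarith
    · have : f b ≤ r x + β := by
        rcases cls b n1' n2' n3' with hv | hv | hv | ⟨a1, a2, a3⟩
        · have := cWX a ha b hv e
          rw [fX b hv]; linarith
        · rw [fW b hv]; linarith
        · rw [fA b hv]; linarith
        · rcases fO b a1 a2 a3 n1' n2' n3' with ⟨e', q⟩ | ⟨e', q⟩ | ⟨e', q⟩ | ⟨-, -, -, q⟩ <;>
            rw [q] <;> linarith
      rw [fW a ha]; linarith
    · have : f b ≤ r x + β' := by
        rcases cls b n1' n2' n3' with hv | hv | hv | ⟨a1, a2, a3⟩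
        · have := cAX a ha b hv e
          rw [fX b hv]; linarith
        · rw [fW b hv]; linarith
        · rw [fA b hv]; linarith
        · rcases fO b a1 a2 a3 n1' n2' n3' with ⟨e', q⟩ | ⟨e', q⟩ | ⟨e', q⟩ | ⟨-, -, -, q⟩
          · rw [q]; linarith
          · exact absurd ha (hEwA b a e' e.symm)
          · rw [q]
          · rw [q]; linarith
      rw [fA a ha]; linarith
    · have : r x ≤ f a := by
        rcases fO a a1 a2 a3 n1 n2 n3 with ⟨e', q⟩ | ⟨e', q⟩ | ⟨e', q⟩ | ⟨-, -, -, q⟩ <;>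
          rw [q] <;> linarith
      linarith
  refine ⟨f, ⟨?_, ?_⟩, ?_, ?_, ?_, ?_, ?_, ?_, ?_⟩
  · intro u v h
    by_cases u1 : u = x
    · subst u1; exact c1x v h
    by_cases u2 : u = w
    · subst u2; exact c1w v h
    by_cases u3 : u = y
    · subst u3; exact c1y v h
    by_cases v1 : v = x
    · subst v1; rw [abs_sub_comm, add_comm]; exact c1x u h.symm
    by_cases v2 : v = w
    · subst v2; rw [abs_sub_comm, add_comm]; exact c1w u h.symm
    by_cases v3 : v = y
    · subst v3; rw [abs_sub_comm, add_comm]; exact c1y u h.symm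
    have := range u u1 u2 u3
    have := range v v1 v2 v3
    have := hR.one_le u; have := hR.one_le v
    rw [abs_lt]; constructor <;> linarith
  · intro u v h
    have er := hR.eq_of_adj h
    by_cases u1 : u = x
    · subst u1; exact c2x v h
    by_cases u2 : u = w
    · subst u2; exact c2w v h
    by_cases u3 : u = y
    · subst u3; exact c2y v u2 h
    by_cases v1 : v = x
    · subst v1; rw [abs_sub_comm, er]; exact c2x u h.symm
    by_cases v2 : v = w
    · subst v2; rw [abs_sub_comm, er]; exact c2w u h.symm
    by_cases v3 : v = y
    · subst v3; rw [abs_sub_comm, er]; exact c2y u v2 h.symm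
    have h1 := c2 u v u1 u2 u3 v1 v2 v3 h
    have h2 := c2 v u v1 v2 v3 u1 u2 u3 h.symm
    rw [abs_le]; constructor <;> linarith
  · intro z hz
    rw [fx, fX z hz]
    exact le_trans (by linarith) (neg_le_abs _)
  · intro z hz
    rw [fw, fW z hz]
    exact le_trans (by linarith) (le_abs_self _)
  · intro z hz
    rw [fw, fy, fA z hz]
    exact ⟨le_trans (by linarith) (le_abs_self _), le_trans (by linarith) (le_abs_self _)⟩
  · rw [fx, fw]
    exact le_trans (by linarith) (neg_le_abs _)
  · rw [fx, fy]
    exact le_trans (by linarith) (neg_le_abs _)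
  · intro v a1 a2 a3 n1 n2 n3
    have := hR.le v
    rw [fx]
    refine le_trans (max_le ?_ ?_) (neg_le_abs _) <;>
    rcases fO v a1 a2 a3 n1 n2 n3 with ⟨e, q⟩ | ⟨e, q⟩ | ⟨e, q⟩ | ⟨-, -, -, q⟩ <;> rw [q] <;>
      have := @hR.eq_of_adj x v <;> first | linarith | linarith [this e]
  · intro v a1 a2 a3 n1 n2 n3 hy
    have := hR.le v
    rw [fw]
    rcases fO v a1 a2 a3 n1 n2 n3 with ⟨e, q⟩ | ⟨e, q⟩ | ⟨e, q⟩ | ⟨-, -, -, q⟩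
    · rw [q]
      exact le_trans (max_le (by linarith) (by linarith)) (le_abs_self _)
    · have := hR.eq_of_adj e
      rw [q]
      exact le_trans (max_le (by linarith) (by linarith)) (le_abs_self _)
    · have h := hy.resolve_left (not_not.2 e)
      have := hyw h
      have := hR.eq_of_adj e
      rw [h] at this
      rw [q]
      exact le_trans (max_le (by linarith) (by linarith)) (le_abs_self _)
    · rw [q]
      exact le_trans (max_le (by linarith) (by linarith)) (le_abs_self _)

theorem Resolved.of_insert {V : Type*} {G E : SimpleGraph V} {r : V → ℝ} {U U' T : Set V}
    {k : ℕ} {F' : List (V → ℝ)} (hF' : ∀ f ∈ F', IsCoord G E r f)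
    (hU : ∀ v ∈ U, v ∈ U' ∨ v ∈ T)
    (sepT : ∀ u ∈ T, ∀ v ∈ T, u ≠ v → ∃ f ∈ F', r u + r v ≤ |f u - f v|)
    (indT : ∀ u ∈ T, ∀ v ∈ T, ¬ G.Adj u v)
    (sep : ∀ u ∈ T, ∀ v ∈ U', ¬ G.Adj u v → ∃ f ∈ F', r u + r v ≤ |f u - f v|)
    (far : ∀ u ∈ T, ∀ v, v ∉ U' → v ∉ T → G.Adj u v →
      ∃ f ∈ F', max (r u) (r v) ≤ |f u - f v|)
    (h : Resolved G E r U' k) : Resolved G E r U (k + F'.length) := by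
  obtain ⟨F, rfl, hF, hsep, hfar⟩ := h
  refine ⟨F ++ F', by simp, ?_, ?_, ?_⟩
  · intro f hf
    rcases List.mem_append.1 hf with h | h
    exacts [hF f h, hF' f h]
  · intro u hu v hv hne huv
    rcases hU u hu with hu | hu
    · rcases hU v hv with hv | hv
      · obtain ⟨f, hf, h⟩ := hsep u hu v hv hne huv
        exact ⟨f, by simp [hf], h⟩
      · obtain ⟨f, hf, h⟩ := sep v hv u hu fun h => huv h.symm
        exact ⟨f, by simp [hf], by rwa [add_comm, abs_sub_comm]⟩
    · rcases hU v hv with hv | hv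
      · obtain ⟨f, hf, h⟩ := sep u hu v hv huv
        exact ⟨f, by simp [hf], h⟩
      · obtain ⟨f, hf, h⟩ := sepT u hu v hv hne
        exact ⟨f, by simp [hf], h⟩
  · intro u hu v huv
    rcases hU u hu with hu | hu
    · obtain ⟨f, hf, h⟩ := hfar u hu v huv
      exact ⟨f, by simp [hf], h⟩
    · by_cases hv : v ∈ U'
      · obtain ⟨f, hf, h⟩ := hfar v hv u huv.symm
        exact ⟨f, by simp [hf], by rwa [max_comm, abs_sub_comm]⟩
      · obtain ⟨f, hf, h⟩ := far u hu v hv (fun hv => indT u hu v hv huv) huv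
        exact ⟨f, by simp [hf], h⟩

theorem exists_attained_bound {V : Type*} [Finite V] (r : V → ℝ) (hr : ∀ v, 1 ≤ r v)
    (p : V → Prop) : ∃ b : ℝ, 9 / 10 ≤ b ∧ (∀ a, p a → r a ≤ b) ∧
      (b = 9 / 10 ∨ ∃ a, p a ∧ r a = b) := by
  by_cases h : ∃ a, p a
  · obtain ⟨a, ha, hmax⟩ := Set.exists_max_image {a | p a} r (Set.toFinite _) h
    exact ⟨r a, by linarith [hr a], hmax, Or.inr ⟨a, ha, rfl⟩⟩
  · exact ⟨9 / 10, le_rfl, fun a ha => absurd ⟨a, ha⟩ h, Or.inl rfl⟩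

theorem Resolved.pair {V : Type*} [Finite V] {G E : SimpleGraph V} {r : V → ℝ}
    (hR : IsRadii G E r) {U U' : Set V} {k : ℕ} {x w : V} (hxw : ¬ G.Adj x w) (nxw : x ≠ w)
    (hx : x ∉ U') (hw : w ∉ U') (hd : ∀ v, E.Adj x v → ¬ E.Adj w v)
    (hZ : ∀ z ∈ U', ¬ G.Adj x z → G.Adj w z)
    (hlt : ∀ a ∈ U', ∀ b ∈ U', E.Adj a b → r a < r x ∧ r a < r w)
    (hU : ∀ v ∈ U, v ∈ U' ∨ v = x ∨ v = w) (h : Resolved G E r U' k) :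
    Resolved G E r U (k + 1) := by
  obtain ⟨β, hβ9, hβ, hβa⟩ := exists_attained_bound r hR.one_le
    fun a => a ∈ U' ∧ ∃ b ∈ U', E.Adj a b
  have hβx : β < r x ∧ β < r w := by
    have := hR.one_le x; have := hR.one_le w
    rcases hβa with h | ⟨a, ⟨ha, b, hb, hab⟩, rfl⟩
    · constructor <;> linarith
    · exact hlt a ha b hb hab
  obtain ⟨f, hf, s1, s2, -, s3, -, s4, s5⟩ := hR.exists_coord (x := x) (w := w) (y := w)
    (X := {z | z ∈ U' ∧ ¬ G.Adj x z}) (W := {z | z ∈ U' ∧ ¬ G.Adj w z}) (A := ∅) (β := β)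
    (β' := β) hxw hxw (G.irrefl) nxw nxw (fun z hz => hz.2) (fun z hz => hz.2) (by simp)
    (by simp [hx]) (by simp [hw]) (by simp [hw]) (fun z hz hz' => hz'.2 (hZ z hz.1 hz.2))
    (by simp) (by simp) hβ9 le_rfl hβx.1.le hβx.2 hβx.2.le (fun _ => rfl)
    (fun z hz h => absurd h hz.2) (fun v _ => Or.inr (Or.inr hβx.1))
    (fun v hv => ⟨fun h => h.2 (hR.sub hv), Or.inr hβx.2⟩) hd hd (fun _ _ _ => rfl) (by simp)
    (fun a ha b hb hab => hβ a ⟨ha.1, b, hb.1, hab⟩) (by simp)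
  refine h.of_insert (T := {x, w}) (F' := [f]) (by simpa using hf) (by simpa using hU) ?_ ?_ ?_ ?_
  · rintro u (rfl | rfl) v (rfl | rfl) hne
    · exact absurd rfl hne
    · exact ⟨f, by simp, s3⟩
    · exact ⟨f, by simp, by rwa [add_comm, abs_sub_comm]⟩
    · exact absurd rfl hne
  · rintro u (rfl | rfl) v (rfl | rfl)
    · exact G.irrefl
    · exact hxw
    · exact fun h => hxw h.symm
    · exact G.irrefl
  · rintro u (rfl | rfl) v hv huv
    · exact ⟨f, by simp, s1 v ⟨hv, huv⟩⟩
    · exact ⟨f, by simp, s2 v ⟨hv, huv⟩⟩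
  · rintro u (rfl | rfl) v hv hvT -
    · exact ⟨f, by simp, s4 v (fun h => hv h.1) (fun h => hv h.1) (by simp)
        (fun h => hvT (by simp [h])) (fun h => hvT (by simp [h])) (fun h => hvT (by simp [h]))⟩
    · exact ⟨f, by simp, s5 v (fun h => hv h.1) (fun h => hv h.1) (by simp)
        (fun h => hvT (by simp [h])) (fun h => hvT (by simp [h])) (fun h => hvT (by simp [h]))
        (Or.inr rfl)⟩

/-- Adding three pairwise non-adjacent vertices costs two coordinates, provided that the
levels `β`, `β'`, `γ`, `γ'` dominate the radii of the edges of `E` which could be broken. -/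
theorem Resolved.triple_of_levels {V : Type*} {G E : SimpleGraph V} {r : V → ℝ}
    (hR : IsRadii G E r) {U U' : Set V} {k : ℕ} {x w y : V}
    (hxw : ¬ G.Adj x w) (hxy : ¬ G.Adj x y) (hwy : ¬ G.Adj w y)
    (nxw : x ≠ w) (nxy : x ≠ y) (nwy : w ≠ y) (hx : x ∉ U') (hw : w ∉ U') (hy : y ∉ U')
    (dxw : ∀ v, E.Adj x v → ¬ E.Adj w v) (dxy : ∀ v, E.Adj x v → ¬ E.Adj y v)
    (dwy : ∀ v, E.Adj w v → ¬ E.Adj y v)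
    (hwA : ∀ v z, E.Adj w v → E.Adj v z → z ∈ U' → ¬ G.Adj x z → ¬ G.Adj w z → G.Adj y z)
    {β β' γ γ' : ℝ} (hβ9 : 9 / 10 ≤ β') (hββ : β' < β) (hβx : β < r x) (hβw : β < r w)
    (hβy : β' ≤ r y) (hyβ : ∀ v, E.Adj y v → (v ∈ U' ∧ ¬ G.Adj x v) ∨ β' < r y)
    (hγ9 : 9 / 10 ≤ γ') (hγγ : γ' < γ) (hγy : γ ≤ r y) (hγw : γ < r w) (hγx : γ' < r x)
    (hyγ : ∀ v, E.Adj y v → (v ∈ U' ∧ ¬ G.Adj w v) ∨ γ < r y)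
    (cβ : ∀ a ∈ U', ∀ b ∈ U', E.Adj a b → r a ≤ β)
    (cβ' : ∀ a ∈ U', ∀ b ∈ U', ¬ G.Adj x a → ¬ G.Adj w a → ¬ G.Adj y a → ¬ G.Adj x b →
      E.Adj a b → r a ≤ β')
    (cγ : ∀ a ∈ U', ∀ b ∈ U', ¬ G.Adj w a → G.Adj y a → (E.Adj y a ∨ ¬ G.Adj x a) →
      ¬ G.Adj y b → E.Adj a b → r a ≤ γ)
    (cγ' : ∀ a ∈ U', ∀ b ∈ U', ¬ G.Adj x a → ¬ G.Adj w a → ¬ G.Adj y a → ¬ G.Adj y b →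
      E.Adj a b → r a ≤ γ')
    (hU : ∀ v ∈ U, v ∈ U' ∨ v = x ∨ v = w ∨ v = y) (h : Resolved G E r U' k) :
    Resolved G E r U (k + 2) := by
  have hyx : ¬ G.Adj y x := fun h => hxy h.symm
  have hyw : ¬ G.Adj y w := fun h => hwy h.symm
  have hwx : ¬ G.Adj w x := fun h => hxw h.symm
  obtain ⟨f, hf, s1, s2, s3, s4, s5, s6, s7⟩ := hR.exists_coord (x := x) (w := w) (y := y)
    (X := {z | z ∈ U' ∧ ¬ G.Adj x z ∧ (G.Adj w z ∨ G.Adj y z)})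
    (W := {z | z ∈ U' ∧ ¬ G.Adj w z ∧ G.Adj x z ∧ ¬ E.Adj y z})
    (A := {z | z ∈ U' ∧ ¬ G.Adj x z ∧ ¬ G.Adj w z ∧ ¬ G.Adj y z}) (β := β)
    (β' := β') hxw hxy hwy nxw nxy (fun z hz => hz.2.1) (fun z hz => hz.2.1)
    (fun z hz => ⟨hz.2.2.1, hz.2.2.2⟩) (by simp [hx]) (by simp [hw]) (by simp [hy])
    (fun z hz hz' => hz.2.1 hz'.2.2.1) (fun z hz hz' => hz.2.2.elim hz'.2.2.1 hz'.2.2.2)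
    (fun z hz hz' => hz'.2.1 hz.2.2.1) hβ9 hββ.le hβx.le hβw hβy (fun h => absurd h nwy.symm)
    (fun _ _ _ => hββ) (fun _ _ => Or.inr (Or.inr hβx))
    (fun v hv => ⟨fun h => h.2.2.2 hv, (hyβ v hv).imp_left fun h =>
      ⟨h.1, h.2, Or.inr (hR.sub hv)⟩⟩) dxw dxy (fun v h1 h2 => absurd h2 (dwy v h1))
    (fun v z h1 h2 h3 => h3.2.2.2 (hwA v z h1 h2 h3.1 h3.2.1 h3.2.2.1))
    (fun a ha b hb hab => cβ a ha.1 b hb.1 hab)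
    (fun a ha b hb hab => cβ' a ha.1 b hb.1 ha.2.1 ha.2.2.1 ha.2.2.2 hb.2.1 hab)
  obtain ⟨g, hg, t1, t2, t3, t4, t5, t6, t7⟩ := hR.exists_coord (x := y) (w := w) (y := x)
    (X := {z | z ∈ U' ∧ ¬ G.Adj y z ∧ (G.Adj w z ∨ G.Adj x z)})
    (W := {z | z ∈ U' ∧ ¬ G.Adj w z ∧ G.Adj y z ∧ (E.Adj y z ∨ ¬ G.Adj x z)})
    (A := {z | z ∈ U' ∧ ¬ G.Adj x z ∧ ¬ G.Adj w z ∧ ¬ G.Adj y z}) (β := γ)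
    (β' := γ') hyw hyx hwx nwy.symm nxy.symm (fun z hz => hz.2.1) (fun z hz => hz.2.1)
    (fun z hz => ⟨hz.2.2.1, hz.2.1⟩) (by simp [hy]) (by simp [hw]) (by simp [hx])
    (fun z hz hz' => hz.2.1 hz'.2.2.1) (fun z hz hz' => hz.2.2.elim hz'.2.2.1 hz'.2.1)
    (fun z hz hz' => hz'.2.2.2 hz.2.2.1) hγ9 hγγ.le hγy hγw hγx.le (fun h => absurd h nxw)
    (fun _ _ _ => hγγ)
    (fun v hv => (hyγ v hv).imp (fun h => ⟨h.1, h.2, hR.sub hv, Or.inl hv⟩) Or.inr)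
    (fun v hv => ⟨fun h => h.2.2.2.elim (dxy v hv) fun h => h (hR.sub hv), Or.inr hγx⟩)
    (fun v h1 h2 => dwy v h2 h1) (fun v h1 h2 => dxy v h2 h1)
    (fun v h1 h2 => absurd h1 (dxw v h2))
    (fun v z h1 h2 h3 => h3.2.2.2 (hwA v z h1 h2 h3.1 h3.2.1 h3.2.2.1))
    (fun a ha b hb hab => cγ a ha.1 b hb.1 ha.2.1 ha.2.2.1 ha.2.2.2 hb.2.1 hab)
    (fun a ha b hb hab => cγ' a ha.1 b hb.1 ha.2.1 ha.2.2.1 ha.2.2.2 hb.2.1 hab)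
  refine h.of_insert (T := {x, w, y}) (F' := [f, g]) (by simpa using ⟨hf, hg⟩)
    (by simpa using hU) ?_ ?_ ?_ ?_
  · rintro u (rfl | rfl | rfl) v (rfl | rfl | rfl) hne
    · exact absurd rfl hne
    · exact ⟨f, by simp, s4⟩
    · exact ⟨f, by simp, s5⟩
    · exact ⟨f, by simp, by rwa [add_comm, abs_sub_comm]⟩
    · exact absurd rfl hne
    · exact ⟨g, by simp, by rwa [add_comm, abs_sub_comm]⟩
    · exact ⟨g, by simp, t5⟩
    · exact ⟨g, by simp, t4⟩
    · exact absurd rfl hne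
  · rintro u (rfl | rfl | rfl) v (rfl | rfl | rfl) <;> first | exact G.irrefl | assumption
  · rintro u (rfl | rfl | rfl) v hv huv
    · by_cases hA : ¬ G.Adj w v ∧ ¬ G.Adj y v
      · exact ⟨g, by simp, (t3 v ⟨hv, huv, hA⟩).2⟩
      · exact ⟨f, by simp, s1 v ⟨hv, huv, by tauto⟩⟩
    · by_cases h1 : G.Adj x v
      · by_cases h2 : E.Adj y v
        · exact ⟨g, by simp, t2 v ⟨hv, huv, hR.sub h2, Or.inl h2⟩⟩
        · exact ⟨f, by simp, s2 v ⟨hv, huv, h1, h2⟩⟩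
      · by_cases h2 : G.Adj y v
        · exact ⟨g, by simp, t2 v ⟨hv, huv, h2, Or.inr h1⟩⟩
        · exact ⟨g, by simp, (t3 v ⟨hv, h1, huv, h2⟩).1⟩
    · by_cases hA : ¬ G.Adj w v ∧ ¬ G.Adj x v
      · exact ⟨f, by simp, (s3 v ⟨hv, hA.2, hA.1, huv⟩).2⟩
      · exact ⟨g, by simp, t1 v ⟨hv, huv, by tauto⟩⟩
  · rintro u hu v hv hvT -
    have v1 : v ≠ x := fun h => hvT (by simp [h])
    have v2 : v ≠ w := fun h => hvT (by simp [h])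
    have v3 : v ≠ y := fun h => hvT (by simp [h])
    rcases hu with rfl | rfl | rfl
    · exact ⟨f, by simp, s6 v (fun h => hv h.1) (fun h => hv h.1) (fun h => hv h.1) v1 v2 v3⟩
    · by_cases h : E.Adj y v
      · exact ⟨g, by simp, t7 v (fun h => hv h.1) (fun h => hv h.1) (fun h => hv h.1) v3 v2 v1
          (Or.inl fun h' => dxy v h' h)⟩
      · exact ⟨f, by simp, s7 v (fun h => hv h.1) (fun h => hv h.1) (fun h => hv h.1) v1 v2 v3
          (Or.inl h)⟩
    · exact ⟨g, by simp, t6 v (fun h => hv h.1) (fun h => hv h.1) (fun h => hv h.1) v3 v2 v1⟩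

theorem Resolved.triple {V : Type*} [Finite V] {G E : SimpleGraph V} {r : V → ℝ}
    (hR : IsRadii G E r) {U U' : Set V} {k : ℕ} {x w y : V}
    (hxw : ¬ G.Adj x w) (hxy : ¬ G.Adj x y) (hwy : ¬ G.Adj w y)
    (nxw : x ≠ w) (nxy : x ≠ y) (nwy : w ≠ y) (hx : x ∉ U') (hw : w ∉ U') (hy : y ∉ U')
    (dxw : ∀ v, E.Adj x v → ¬ E.Adj w v) (dxy : ∀ v, E.Adj x v → ¬ E.Adj y v)
    (dwy : ∀ v, E.Adj w v → ¬ E.Adj y v)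
    (hwA : ∀ v z, E.Adj w v → E.Adj v z → z ∈ U' → ¬ G.Adj x z → ¬ G.Adj w z → G.Adj y z)
    (hlt : ∀ a ∈ U', ∀ b ∈ U', E.Adj a b → r a < r x ∧ r a < r w ∧ r a < r y)
    (hU : ∀ v ∈ U, v ∈ U' ∨ v = x ∨ v = w ∨ v = y) (h : Resolved G E r U' k) :
    Resolved G E r U (k + 2) := by
  obtain ⟨β', hβ9, hβ, hβa⟩ := exists_attained_bound r hR.one_le
    fun a => a ∈ U' ∧ ∃ b ∈ U', E.Adj a b
  have hβx : β' < r x ∧ β' < r w ∧ β' < r y := by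
    have := hR.one_le x; have := hR.one_le w; have := hR.one_le y
    rcases hβa with h | ⟨a, ⟨ha, b, hb, hab⟩, rfl⟩
    · refine ⟨?_, ?_, ?_⟩ <;> linarith
    · exact hlt a ha b hb hab
  obtain ⟨β, hββ, hβ2⟩ := exists_between (lt_min hβx.1 (lt_min hβx.2.1 hβx.2.2))
  have b1 : β < r x := hβ2.trans_le (min_le_left _ _)
  have b2 : β < r w := hβ2.trans_le ((min_le_right _ _).trans (min_le_left _ _))
  have b3 : β < r y := hβ2.trans_le ((min_le_right _ _).trans (min_le_right _ _))
  exact h.triple_of_levels hR hxw hxy hwy nxw nxy nwy hx hw hy dxw dxy dwy hwA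
    (β := β) (β' := β') (γ := β) (γ' := β') hβ9 hββ b1 b2 hβx.2.2.le (fun _ _ => Or.inr hβx.2.2)
    hβ9 hββ b3.le b2 hβx.1 (fun _ _ => Or.inr b3)
    (fun a ha b hb hab => (hβ a ⟨ha, b, hb, hab⟩).trans hββ.le)
    (fun a ha b hb _ _ _ _ hab => hβ a ⟨ha, b, hb, hab⟩)
    (fun a ha b hb _ _ _ _ hab => (hβ a ⟨ha, b, hb, hab⟩).trans hββ.le)
    (fun a ha b hb _ _ _ _ hab => hβ a ⟨ha, b, hb, hab⟩) hU

/-- A version of `Resolved.triple` for a vertex `y` with a single neighbour `c` in `E`,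
whose radius may be small. -/
theorem Resolved.triple_leaf {V : Type*} [Finite V] {G E : SimpleGraph V} {r : V → ℝ}
    (hR : IsRadii G E r) {U U' : Set V} {k : ℕ} {x w y c : V}
    (hxw : ¬ G.Adj x w) (hxy : ¬ G.Adj x y) (hwy : ¬ G.Adj w y)
    (nxw : x ≠ w) (nxy : x ≠ y) (nwy : w ≠ y) (hx : x ∉ U') (hw : w ∉ U') (hy : y ∉ U')
    (dxw : ∀ v, E.Adj x v → ¬ E.Adj w v) (dxy : ∀ v, E.Adj x v → ¬ E.Adj y v)
    (dwy : ∀ v, E.Adj w v → ¬ E.Adj y v)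
    (hwA : ∀ v z, E.Adj w v → E.Adj v z → z ∈ U' → ¬ G.Adj x z → ¬ G.Adj w z → G.Adj y z)
    (hyc : E.Adj y c) (hc : ∀ v, E.Adj y v → v = c)
    (hlt : ∀ a ∈ U', ∀ b ∈ U', E.Adj a b → r a < r x ∧ r a < r w)
    (hle : ∀ a ∈ U', ∀ b ∈ U', ¬ G.Adj x a → ¬ G.Adj w a → ¬ G.Adj y a → E.Adj a b →
      r a ≤ r y ∧ (r a = r y → b = c))
    (hno : ∀ a ∈ U', ¬ G.Adj x a → ¬ G.Adj w a → ¬ G.Adj y a)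
    (hU : ∀ v ∈ U, v ∈ U' ∨ v = x ∨ v = w ∨ v = y) (h : Resolved G E r U' k) :
    Resolved G E r U (k + 2) := by
  have rx1 := hR.one_le x; have rw1 := hR.one_le w; have ry1 := hR.one_le y
  obtain ⟨s, hs9, hs, hsa⟩ := exists_attained_bound r hR.one_le
    fun a => a ∈ U' ∧ ∃ b ∈ U', E.Adj a b
  have hsx : s < r x ∧ s < r w := by
    rcases hsa with h | ⟨a, ⟨ha, b, hb, hab⟩, rfl⟩
    · constructor <;> linarith
    · exact hlt a ha b hb hab
  obtain ⟨β, hsβ, hβ⟩ := exists_between (lt_min hsx.1 hsx.2)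
  have b1 : β < r x := hβ.trans_le (min_le_left _ _)
  have b2 : β < r w := hβ.trans_le (min_le_right _ _)
  obtain ⟨β', hβ9, hβ', hβa⟩ := exists_attained_bound r hR.one_le
    fun a => a ∈ U' ∧ ¬ G.Adj x a ∧ ¬ G.Adj w a ∧ ¬ G.Adj y a ∧
      ∃ b ∈ U', ¬ G.Adj x b ∧ E.Adj a b
  have b4 : β' ≤ r y := by
    rcases hβa with h | ⟨a, ⟨ha, a1, a2, a3, b, hb, -, hab⟩, rfl⟩
    · linarith
    · exact (hle a ha b hb a1 a2 a3 hab).1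
  have b5 : β' < β := by
    rcases hβa with h | ⟨a, ⟨ha, a1, a2, a3, b, hb, -, hab⟩, rfl⟩
    · linarith
    · exact (hs a ⟨ha, b, hb, hab⟩).trans_lt hsβ
  have b6 : ∀ v, E.Adj y v → (v ∈ U' ∧ ¬ G.Adj x v) ∨ β' < r y := by
    intro v hv
    rcases b4.lt_or_eq with h | h
    · exact Or.inr h
    rcases hβa with h' | ⟨a, ⟨ha, a1, a2, a3, b, hb, hxb, hab⟩, rfl⟩
    · linarith
    · have := (hle a ha b hb a1 a2 a3 hab).2 h
      rw [hc v hv, ← this]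
      exact Or.inl ⟨hb, hxb⟩
  obtain ⟨γ', hγ9, hγ', hγa⟩ := exists_attained_bound r hR.one_le
    fun a => a ∈ U' ∧ ¬ G.Adj x a ∧ ¬ G.Adj w a ∧ ¬ G.Adj y a ∧
      ∃ b ∈ U', ¬ G.Adj y b ∧ E.Adj a b
  have g1 : γ' < r y ∧ γ' < r x ∧ γ' < r w := by
    rcases hγa with h | ⟨a, ⟨ha, a1, a2, a3, b, hb, hyb, hab⟩, rfl⟩
    · refine ⟨?_, ?_, ?_⟩ <;> linarith
    · refine ⟨lt_of_le_of_ne (hle a ha b hb a1 a2 a3 hab).1 fun h => ?_, hlt a ha b hb hab⟩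
      rw [(hle a ha b hb a1 a2 a3 hab).2 h] at hyb
      exact hyb (hR.sub hyc)
  obtain ⟨γ, g2, g3, g4, g5, g6⟩ : ∃ γ, γ' < γ ∧ γ ≤ r y ∧ γ < r w ∧
      (∀ v, E.Adj y v → (v ∈ U' ∧ ¬ G.Adj w v) ∨ γ < r y) ∧
      (∀ a ∈ U', ∀ b ∈ U', ¬ G.Adj w a → G.Adj y a → (E.Adj y a ∨ ¬ G.Adj x a) →
      ¬ G.Adj y b → E.Adj a b → r a ≤ γ) := by
    by_cases hcc : c ∈ U' ∧ ¬ G.Adj w c ∧ ∃ b ∈ U', E.Adj c b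
    · obtain ⟨c1, c2, b, hb, hcb⟩ := hcc
      have e := hR.eq_of_adj hyc
      refine ⟨r y, g1.1, le_rfl, ?_, ?_, ?_⟩
      · rw [e]
        exact (hlt c c1 b hb hcb).2
      · intro v hv
        rw [hc v hv]
        exact Or.inl ⟨c1, c2⟩
      · intro a ha b' _ h1 h2 h3 _ _
        rcases h3 with h3 | h3
        · rw [hc a h3, e]
        · exact absurd h2 (hno a ha h3 h1)
    · obtain ⟨γ, h1, h2⟩ := exists_between (lt_min g1.1 g1.2.2)
      have h3 : γ < r y := h2.trans_le (min_le_left _ _)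
      refine ⟨γ, h1, h3.le, h2.trans_le (min_le_right _ _), fun _ _ => Or.inr h3, ?_⟩
      intro a ha b hb h1 h2 h3 _ hab
      rcases h3 with h3 | h3
      · have := hc a h3
        subst this
        exact absurd ⟨ha, h1, b, hb, hab⟩ hcc
      · exact absurd h2 (hno a ha h3 h1)
  exact h.triple_of_levels hR hxw hxy hwy nxw nxy nwy hx hw hy dxw dxy dwy hwA
    hβ9 b5 b1 b2 b4 b6 hγ9 g2 g3 g4 g1.2.1 g5
    (fun a ha b hb hab => (hs a ⟨ha, b, hb, hab⟩).trans hsβ.le)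
    (fun a ha b hb a1 a2 a3 b1 hab => hβ' a ⟨ha, a1, a2, a3, b, hb, b1, hab⟩) g6
    (fun a ha b hb a1 a2 a3 b1 hab => hγ' a ⟨ha, a1, a2, a3, b, hb, b1, hab⟩) hU

theorem Finset.exists_rank_antitone {V : Type*} (r : V → ℝ) (Q : Finset V) :
    ∃ c : V → ℕ, Set.InjOn c Q ∧ (∀ a ∈ Q, 1 ≤ c a ∧ c a ≤ Q.card) ∧
      ∀ a ∈ Q, ∀ b ∈ Q, c a < c b → r b ≤ r a := by
  classical
  induction hn : Q.card generalizing Q with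
  | zero =>
    rw [Finset.card_eq_zero] at hn
    subst hn
    exact ⟨fun _ => 0, by simp, by simp, by simp⟩
  | succ n ih =>
    have hne : Q.Nonempty := by
      rw [← Finset.card_pos]; omega
    obtain ⟨m, hm, hmin⟩ := Q.exists_min_image r hne
    have hcard : (Q.erase m).card = n := by rw [Finset.card_erase_of_mem hm]; omega
    obtain ⟨c, hinj, hc, hmono⟩ := ih (Q.erase m) hcard
    refine ⟨fun v => if v = m then n + 1 else c v, ?_, ?_, ?_⟩
    · intro a ha b hb hab
      by_cases h1 : a = m <;> by_cases h2 : b = m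
      · rw [h1, h2]
      · have := hc b (Finset.mem_erase.2 ⟨h2, hb⟩)
        simp only [h1, h2, if_true, if_false] at hab
        omega
      · have := hc a (Finset.mem_erase.2 ⟨h1, ha⟩)
        simp only [h1, h2, if_true, if_false] at hab
        omega
      · simp only [h1, h2, if_false] at hab
        exact hinj (Finset.mem_coe.2 (Finset.mem_erase.2 ⟨h1, ha⟩))
          (Finset.mem_coe.2 (Finset.mem_erase.2 ⟨h2, hb⟩)) hab
    · intro a ha
      by_cases h1 : a = m
      · simp [h1]
      · have := hc a (Finset.mem_erase.2 ⟨h1, ha⟩)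
        simp only [h1, if_false]
        omega
    · intro a ha b hb hab
      by_cases h2 : b = m
      · rw [h2]; exact hmin a ha
      by_cases h1 : a = m
      · have := hc b (Finset.mem_erase.2 ⟨h2, hb⟩)
        simp only [h1, h2, if_true, if_false] at hab
        omega
      · simp only [h1, h2, if_false] at hab
        exact hmono a (Finset.mem_erase.2 ⟨h1, ha⟩) b (Finset.mem_erase.2 ⟨h2, hb⟩) hab

theorem Nat.exists_testBit_ne_of_lt_two_pow {a b k : ℕ} (hab : a ≠ b) (ha : a < 2 ^ k)
    (hb : b < 2 ^ k) : ∃ j < k, a.testBit j ≠ b.testBit j := by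
  obtain ⟨j, hj⟩ := Nat.exists_testBit_ne_of_ne hab
  refine ⟨j, ?_, hj⟩
  by_contra h
  have h2 : 2 ^ k ≤ 2 ^ j := Nat.pow_le_pow_right (by norm_num) (not_lt.1 h)
  rw [Nat.testBit_lt_two_pow (ha.trans_le h2), Nat.testBit_lt_two_pow (hb.trans_le h2)] at hj
  exact hj rfl

theorem Nat.le_of_testBit_imp {a b : ℕ} (h : ∀ j, a.testBit j = true → b.testBit j = true) :
    a ≤ b := by
  have : a &&& b = a := by
    apply Nat.eq_of_testBit_eq
    intro j
    rw [Nat.testBit_and]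
    cases ha : a.testBit j
    · rfl
    · simp [h j ha]
  rw [← this]
  exact Nat.and_le_right

/-- A clique is resolved by binary codes, larger radii receiving smaller codes. -/
theorem Resolved.of_isClique {V : Type*} {G E : SimpleGraph V} {r : V → ℝ}
    (hR : IsRadii G E r) (Q : Finset V) (hQ : G.IsClique Q)
    (hQ1 : ∀ a ∈ Q, ∀ b ∈ Q, E.Adj a b → r a = 1)
    (hQE : ∀ t, t ∉ Q → ∀ a ∈ Q, ∀ b ∈ Q, E.Adj t a → E.Adj t b → a = b) :
    Resolved G E r Q (Nat.clog 2 (Q.card + 1)) := by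
  classical
  obtain ⟨c, hinj, hc, hmono⟩ := Q.exists_rank_antitone r
  set k := Nat.clog 2 (Q.card + 1) with hk
  have hck : ∀ a ∈ Q, c a < 2 ^ k := by
    intro a ha
    have : Q.card + 1 ≤ 2 ^ k := Nat.le_pow_clog (by norm_num) _
    have := hc a ha
    omega
  let f : ℕ → V → ℝ := fun j v => if v ∈ Q then (if (c v).testBit j then r v else 1 - r v) else
    if ∃ q ∈ Q, E.Adj v q ∧ (c q).testBit j = true then 0 else 1 - r v
  have f1 : ∀ j, ∀ v ∈ Q, (c v).testBit j = true → f j v = r v := fun j v h h' => by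
    simp [f, h, h']
  have f2 : ∀ j, ∀ v ∈ Q, (c v).testBit j = false → f j v = 1 - r v := fun j v h h' => by
    simp [f, h, h']
  have f3 : ∀ j, ∀ v, v ∉ Q → (∃ q ∈ Q, E.Adj v q ∧ (c q).testBit j = true) → f j v = 0 :=
    fun j v h h' => by simp only [f, if_neg h, if_pos h']
  have f4 : ∀ j, ∀ v, v ∉ Q → (¬ ∃ q ∈ Q, E.Adj v q ∧ (c q).testBit j = true) →
      f j v = 1 - r v := fun j v h h' => by simp only [f, if_neg h, if_neg h']
  have out : ∀ j v, v ∉ Q → 1 - r v ≤ f j v ∧ f j v ≤ 0 := by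
    intro j v hv
    have := hR.one_le v
    by_cases h : ∃ q ∈ Q, E.Adj v q ∧ (c q).testBit j = true
    · rw [f3 j v hv h]; constructor <;> linarith
    · rw [f4 j v hv h]; constructor <;> linarith
  have bd : ∀ j v, 1 - r v ≤ f j v ∧ f j v ≤ r v := by
    intro j v
    have := hR.one_le v
    by_cases hv : v ∈ Q
    · cases h : (c v).testBit j
      · rw [f2 j v hv h]; constructor <;> linarith
      · rw [f1 j v hv h]; constructor <;> linarith
    · have := out j v hv
      constructor <;> linarith
  have mixed : ∀ j a b, a ∈ Q → b ∉ Q → E.Adj a b → |f j a - f j b| ≤ r a := by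
    intro j a b ha hb hab
    have := hR.one_le a
    have e := hR.eq_of_adj hab
    cases h : (c a).testBit j
    · have : ¬ ∃ q ∈ Q, E.Adj b q ∧ (c q).testBit j = true := by
        rintro ⟨q, hq, hbq, hj⟩
        rw [hQE b hb q hq a ha hbq hab.symm, h] at hj
        exact absurd hj (by simp)
      rw [f2 j a ha h, f4 j b hb this, e, sub_self, abs_zero]
      linarith
    · rw [f1 j a ha h, f3 j b hb ⟨a, ha, hab.symm, h⟩, sub_zero, abs_of_nonneg (by linarith)]
  refine ⟨(List.range k).map f, by simp, ?_, ?_, ?_⟩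
  · intro g hg
    obtain ⟨j, -, rfl⟩ := List.mem_map.1 hg
    constructor
    · intro u v _
      have := bd j u; have := bd j v
      have := hR.one_le u; have := hR.one_le v; have := hR.le u; have := hR.le v
      rw [abs_lt]; constructor <;> linarith
    · intro a b hab
      by_cases ha : a ∈ Q <;> by_cases hb : b ∈ Q
      · have h1 := hQ1 a ha b hb hab
        have h2 := hR.eq_of_adj hab
        have := bd j a; have := bd j b
        rw [abs_le]; constructor <;> linarith
      · exact mixed j a b ha hb hab
      · rw [abs_sub_comm, hR.eq_of_adj hab]
        exact mixed j b a hb ha hab.symm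
      · have := out j a ha; have := out j b hb
        have := hR.one_le a; have := hR.one_le b; have := hR.le a; have := hR.le b
        rw [abs_le]; constructor <;> linarith
  · intro u hu v hv hne huv
    exact absurd (hQ hu hv hne) huv
  · intro q hq t hqt
    have hq : q ∈ Q := hq
    have rq := hR.one_le q; have rt := hR.one_le t
    have done : ∀ j < k, ∀ x, |f j q - f j t| = x → max (r q) (r t) ≤ x →
        ∃ f' ∈ (List.range k).map f, max (r q) (r t) ≤ |f' q - f' t| := fun j hj x hx h =>
      ⟨f j, List.mem_map.2 ⟨j, List.mem_range.2 hj, rfl⟩, by rwa [hx]⟩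
    by_cases ht : t ∈ Q
    · obtain ⟨j, hj, hne⟩ := Nat.exists_testBit_ne_of_lt_two_pow
        (fun h => hqt.ne (hinj hq ht h)) (hck q hq) (hck t ht)
      refine done j hj (r q + r t - 1) ?_ (max_le (by linarith) (by linarith))
      cases h : (c q).testBit j <;> cases h' : (c t).testBit j
      · rw [h, h'] at hne; exact absurd rfl hne
      · rw [f2 j q hq h, f1 j t ht h', abs_sub_comm, abs_of_nonneg (by linarith)]; ring
      · rw [f1 j q hq h, f2 j t ht h', abs_of_nonneg (by linarith)]; ring
      · rw [h, h'] at hne; exact absurd rfl hne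
    · have hlt : ∀ j, (c q).testBit j = true → j < k := by
        intro j hj
        by_contra h
        have h2 : 2 ^ k ≤ 2 ^ j := Nat.pow_le_pow_right (by norm_num) (not_lt.1 h)
        rw [Nat.testBit_lt_two_pow ((hck q hq).trans_le h2)] at hj
        exact absurd hj (by simp)
      by_cases hall : ∀ j, (c q).testBit j = true →
          ∃ q' ∈ Q, E.Adj t q' ∧ (c q').testBit j = true
      · obtain ⟨j, hj⟩ := Nat.exists_testBit_of_ne_zero (x := c q) (by have := hc q hq; omega)
        obtain ⟨p, hp, htp, -⟩ := hall j hj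
        have hle : c q ≤ c p := Nat.le_of_testBit_imp fun i hi => by
          obtain ⟨p', hp', htp', hi'⟩ := hall i hi
          rwa [hQE t ht p hp p' hp' htp htp']
        have hrr : r t ≤ r q := by
          rw [hR.eq_of_adj htp]
          rcases hle.lt_or_eq with h | h
          · exact hmono q hq p hp h
          · rw [hinj hq hp h]
        refine done j (hlt j hj) (r q) ?_ (max_le le_rfl hrr)
        rw [f1 j q hq hj, f3 j t ht (hall j hj), sub_zero, abs_of_nonneg (by linarith)]
      · push Not at hall
        obtain ⟨j, hj, hno⟩ := hall
        refine done j (hlt j hj) (r q + r t - 1) ?_ (max_le (by linarith) (by linarith))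
        rw [f1 j q hq hj, f4 j t ht (by push Not; exact hno), abs_of_nonneg (by linarith)]; ring

/-- An independent set is resolved by binary codes and one further coordinate. -/
theorem Resolved.of_isIndep {V : Type*} {G E : SimpleGraph V} {r : V → ℝ}
    (hR : IsRadii G E r) (L : Finset V) (hL : ∀ u ∈ L, ∀ v ∈ L, ¬ G.Adj u v) :
    Resolved G E r L (Nat.clog 2 L.card + 1) := by
  classical
  obtain ⟨c, hinj, hc, -⟩ := L.exists_rank_antitone r
  set k := Nat.clog 2 L.card with hk
  have hck : ∀ a ∈ L, c a - 1 < 2 ^ k := by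
    intro a ha
    have : L.card ≤ 2 ^ k := Nat.le_pow_clog (by norm_num) _
    have := hc a ha
    omega
  let f : ℕ → V → ℝ := fun j v => if v ∈ L then (if (c v - 1).testBit j then r v else - r v) else 0
  have f1 : ∀ j, ∀ v ∈ L, (c v - 1).testBit j = true → f j v = r v := fun j v h h' => by
    simp [f, h, h']
  have f2 : ∀ j, ∀ v ∈ L, (c v - 1).testBit j = false → f j v = - r v := fun j v h h' => by
    simp [f, h, h']
  have f3 : ∀ j, ∀ v, v ∉ L → f j v = 0 := fun j v h => by simp [f, h]
  let g : V → ℝ := fun v => if v ∈ L then 11 / 10 else if ∃ z ∈ L, E.Adj z v then 11 / 10 - r v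
    else 0
  have g1 : ∀ v ∈ L, g v = 11 / 10 := fun v h => by simp [g, h]
  have g2 : ∀ v, v ∉ L → (∃ z ∈ L, E.Adj z v) → g v = 11 / 10 - r v := fun v h h' => by
    simp only [g, if_neg h, if_pos h']
  have g3 : ∀ v, v ∉ L → (¬ ∃ z ∈ L, E.Adj z v) → g v = 0 := fun v h h' => by
    simp only [g, if_neg h, if_neg h']
  have gout : ∀ v, v ∉ L → 0 ≤ g v ∧ g v ≤ 1 / 10 := by
    intro v hv
    have := hR.one_le v; have := hR.le v
    by_cases h : ∃ z ∈ L, E.Adj z v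
    · rw [g2 v hv h]; constructor <;> linarith
    · rw [g3 v hv h]; constructor <;> linarith
  have gbd : ∀ v, 0 ≤ g v ∧ g v ≤ 11 / 10 := by
    intro v
    by_cases h : v ∈ L
    · rw [g1 v h]; norm_num
    · have := gout v h
      constructor <;> linarith
  have fL : ∀ j, ∀ v ∈ L, |f j v| = r v := by
    intro j v hv
    have := hR.one_le v
    cases h : (c v - 1).testBit j
    · rw [f2 j v hv h, abs_neg, abs_of_nonneg (by linarith)]
    · rw [f1 j v hv h, abs_of_nonneg (by linarith)]
  have fE : ∀ j u v, (u ∉ L ∨ v ∉ L) → |f j u - f j v| ≤ max (r u) (r v) ∧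
      (r u = r v → |f j u - f j v| ≤ r u) := by
    intro j u v h
    have := hR.one_le u; have := hR.one_le v
    have key : |f j u - f j v| ≤ r u ∨ |f j u - f j v| ≤ r v := by
      by_cases hu : u ∈ L
      · rw [f3 j v (h.resolve_left (not_not.2 hu)), sub_zero, fL j u hu]; exact Or.inl le_rfl
      · rw [f3 j u hu, zero_sub, abs_neg]
        right
        by_cases hv : v ∈ L
        · exact (fL j v hv).le
        · rw [f3 j v hv, abs_zero]; linarith
    exact ⟨le_max_iff.2 key, fun e => by rcases key with h | h <;> linarith⟩
  refine ⟨g :: (List.range k).map f, by simp, ?_, ?_, ?_⟩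
  · intro φ hφ
    rcases List.mem_cons.1 hφ with rfl | hφ
    · constructor
      · intro u v _
        have := gbd u; have := gbd v
        have := hR.one_le u; have := hR.one_le v
        rw [abs_lt]; constructor <;> linarith
      · intro u v huv
        have e := hR.eq_of_adj huv
        have := hR.one_le u; have := hR.one_le v; have := hR.le v
        by_cases hu : u ∈ L
        · have hv : v ∉ L := fun hv => hL u hu v hv (hR.sub huv)
          rw [g1 u hu, g2 v hv ⟨u, hu, huv⟩, abs_le]
          constructor <;> linarith
        · by_cases hv : v ∈ L
          · rw [g1 v hv, g2 u hu ⟨v, hv, huv.symm⟩, abs_le]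
            constructor <;> linarith
          · have := gout u hu; have := gout v hv
            rw [abs_le]; constructor <;> linarith
    · obtain ⟨j, -, rfl⟩ := List.mem_map.1 hφ
      constructor
      · intro u v huv
        have h : u ∉ L ∨ v ∉ L := by
          by_contra! h
          exact hL u h.1 v h.2 huv
        have := hR.one_le u; have := hR.one_le v
        exact (fE j u v h).1.trans_lt (max_lt (by linarith) (by linarith))
      · intro u v huv
        have h : u ∉ L ∨ v ∉ L := by
          by_contra! h
          exact hL u h.1 v h.2 (hR.sub huv)
        exact (fE j u v h).2 (hR.eq_of_adj huv)
  · intro u hu v hv hne _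
    have hu : u ∈ L := hu
    have hv : v ∈ L := hv
    have cu := hc u hu; have cv := hc v hv
    obtain ⟨j, hj, hjne⟩ := Nat.exists_testBit_ne_of_lt_two_pow (a := c u - 1) (b := c v - 1)
      (fun h => hne (hinj hu hv (by omega))) (hck u hu) (hck v hv)
    refine ⟨f j, List.mem_cons_of_mem _ (List.mem_map.2 ⟨j, List.mem_range.2 hj, rfl⟩), ?_⟩
    cases h : (c u - 1).testBit j <;> cases h' : (c v - 1).testBit j
    · rw [h, h'] at hjne; exact absurd rfl hjne
    · rw [f2 j u hu h, f1 j v hv h']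
      exact le_trans (by linarith) (neg_le_abs _)
    · rw [f1 j u hu h, f2 j v hv h']
      exact le_trans (by linarith) (le_abs_self _)
    · rw [h, h'] at hjne; exact absurd rfl hjne
  · intro z hz t hzt
    have hz : z ∈ L := hz
    have ht : t ∉ L := fun ht => hL z hz t ht hzt
    have := hR.one_le z; have := hR.one_le t; have := hR.le z; have := hR.le t
    by_cases h : ∃ z' ∈ L, E.Adj z' t
    · have hg : |g z - g t| = r t := by
        rw [g1 z hz, g2 t ht h, abs_of_nonneg (by linarith)]; ring
      by_cases hle : r z ≤ r t
      · exact ⟨g, by simp, by rw [hg, max_eq_right hle]⟩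
      · obtain ⟨z', hz', hzt'⟩ := h
        have hne : z ≠ z' := by
          rintro rfl
          exact hle (hR.eq_of_adj hzt').le
        have hk1 : 0 < k := by
          have : 1 < L.card := Finset.one_lt_card.2 ⟨z, hz, z', hz', hne⟩
          exact Nat.clog_pos (by norm_num) this
        refine ⟨f 0, List.mem_cons_of_mem _ (List.mem_map.2 ⟨0, List.mem_range.2 hk1, rfl⟩), ?_⟩
        rw [f3 0 t ht, sub_zero, fL 0 z hz]
        exact max_le le_rfl (not_le.1 hle).le
    · refine ⟨g, by simp, ?_⟩
      rw [g1 z hz, g3 t ht h, sub_zero, abs_of_nonneg (by norm_num)]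
      exact max_le (hR.le z) (hR.le t)

theorem Nat.three_mul_clog_two_le (m : ℕ) : 3 * Nat.clog 2 m ≤ m + 4 := by
  have key : ∀ k, 3 * (k + 3) ≤ 2 ^ (k + 2) + 5 := by
    intro k
    induction k with
    | zero => norm_num
    | succ k ih =>
      have : 2 ^ (k + 1 + 2) = 2 * 2 ^ (k + 2) := by ring
      have : 4 ≤ 2 ^ (k + 2) := by
        calc 4 = 2 ^ 2 := by norm_num
          _ ≤ 2 ^ (k + 2) := Nat.pow_le_pow_right (by norm_num) (by omega)
      omega
  rcases h : Nat.clog 2 m with _ | n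
  · omega
  have hlt : 2 ^ n < m := by
    rw [← Nat.lt_clog_iff_pow_lt (by norm_num)]
    omega
  rcases n with _ | _ | n
  · simp at hlt; omega
  · simp at hlt; omega
  · have := key n
    rw [show n + 1 + 1 = n + 2 by ring] at hlt
    omega

theorem Resolved.union {V : Type*} {G E : SimpleGraph V} {r : V → ℝ} (hR : IsRadii G E r)
    {U : Set V} {k : ℕ} (h : Resolved G E r U k) (S : Finset V) :
    Resolved G E r (U ∪ S) (k + S.card) := by
  classical
  induction S using Finset.induction_on with
  | empty => simpa using h
  | insert a S ha ih =>
    rw [Finset.card_insert_of_notMem ha, ← add_assoc]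
    refine ih.single hR.one_le (fun _ _ => hR.eq_of_adj) (fun _ _ => hR.sub) a ?_
    intro v hv
    simp only [Finset.coe_insert, Set.mem_union, Set.mem_insert_iff, Finset.mem_coe] at hv ⊢
    tauto

theorem exists_resolved_clique_union_indep {V : Type*} {G E : SimpleGraph V} {r : V → ℝ}
    (hR : IsRadii G E r) (Q L : Finset V) (hQ : G.IsClique Q)
    (hQ1 : ∀ a ∈ Q, ∀ b ∈ Q, E.Adj a b → r a = 1)
    (hQE : ∀ t, t ∉ Q → ∀ a ∈ Q, ∀ b ∈ Q, E.Adj t a → E.Adj t b → a = b)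
    (hL : ∀ u ∈ L, ∀ v ∈ L, ¬ G.Adj u v) :
    ∃ k, Resolved G E r (Q ∪ L : Set V) k ∧ 3 * k ≤ 2 * Q.card + 2 * L.card + 6 := by
  rcases le_or_gt L.card Q.card with h | h
  · refine ⟨_, (Resolved.of_isClique hR Q hQ hQ1 hQE).union hR L, ?_⟩
    have := Nat.three_mul_clog_two_le (Q.card + 1)
    omega
  · rw [Set.union_comm]
    refine ⟨_, (Resolved.of_isIndep hR L hL).union hR Q, ?_⟩
    have := Nat.three_mul_clog_two_le L.card
    omega

/-- The combinatorial data driving the construction: `L` is an independent set of leaves of `E`,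
and the radii of the remaining vertices, apart from those in `Q`, decrease along `ord`. -/
structure IsFrame {V : Type*} (G E : SimpleGraph V) (r : V → ℝ) (L : Set V) (Q : List V)
    (ord : V → ℕ) : Prop where
  radii : IsRadii G E r
  indep : ∀ u ∈ L, ∀ v ∈ L, ¬ G.Adj u v
  disjoint : ∀ {y y' v}, y ∉ L → y' ∉ L → y ≠ y' → E.Adj y v → ¬ E.Adj y' v
  adj_leaf : ∀ {y u v}, y ∉ L → u ∈ L → E.Adj y v → E.Adj u v → G.Adj y u
  leaf : ∀ u ∈ L, ∃ c, E.Adj u c ∧ ∀ v, E.Adj u v → v = c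
  tie : ∀ {a b z c}, a ∈ L → z ∈ L → E.Adj a b → E.Adj z c → r a = r z → b = c
  lt : ∀ {t a b}, t ∉ L → t ∉ Q → E.Adj a b → (a ∉ L → ord t < ord a) →
    (b ∉ L → ord t < ord b) → r a < r t
  eq_one : ∀ a ∈ Q, ∀ b ∈ Q, E.Adj a b → r a = 1

theorem IsFrame.exists_resolved_pairs {V : Type*} [Finite V] {G E : SimpleGraph V} {r : V → ℝ}
    {L : Set V} {Q : List V} {ord : V → ℕ} (hF : IsFrame G E r L Q ord) (hQ : Q.Nodup)
    (hQL : ∀ v ∈ Q, v ∉ L) (hQG : ∀ u ∈ Q, ∀ v ∈ Q, u ≠ v → G.Adj u v)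
    (ps : List (V × V)) (hps : ∀ p ∈ ps, p.1 ∉ L ∧ p.2 ∉ L ∧ ¬ G.Adj p.1 p.2)
    (hord : (ps.flatMap (fun p => [p.1, p.2]) ++ Q).Pairwise fun a b => ord a < ord b)
    (hfree : ∀ a ∈ ps.flatMap (fun p => [p.1, p.2]) ++ Q,
      ∀ b ∈ ps.flatMap (fun p => [p.1, p.2]) ++ Q,
      ∀ c ∈ ps.flatMap (fun p => [p.1, p.2]) ++ Q, a ≠ b → b ≠ c → a ≠ c →
      ¬ G.Adj a b → ¬ G.Adj b c → G.Adj a c)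
    (S : Finset V) (hS : ∀ v ∈ S, v ∈ L) :
    ∃ k, Resolved G E r {v | v ∈ ps.flatMap (fun p => [p.1, p.2]) ++ Q ∨ v ∈ S} k ∧
      3 * k ≤ 4 * ps.length + 2 * Q.length + 2 * S.card + 6 := by
  classical
  induction ps generalizing S with
  | nil =>
    obtain ⟨k, hk, hk'⟩ := exists_resolved_clique_union_indep hF.radii Q.toFinset S
      (fun u hu v hv hne => hQG u (by simpa using hu) v (by simpa using hv) hne)
      (fun a ha b hb => hF.eq_one a (by simpa using ha) b (by simpa using hb))
      (fun t _ a ha b hb hta htb => by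
        by_contra hne
        exact hF.disjoint (hQL a (by simpa using ha)) (hQL b (by simpa using hb)) hne
          hta.symm htb.symm)
      (fun u hu v hv => hF.indep u (hS u hu) v (hS v hv))
    refine ⟨k, ?_, ?_⟩
    · convert hk using 1
      ext v
      simp
    · rw [List.toFinset_card_of_nodup hQ] at hk'
      simpa using hk'
  | cons p ps ih =>
    obtain ⟨x, w⟩ := p
    set R := ps.flatMap (fun p => [p.1, p.2]) ++ Q with hRdef
    have hflat : ((x, w) :: ps).flatMap (fun p => [p.1, p.2]) ++ Q = x :: w :: R := by
      simp [hRdef]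
    rw [hflat] at hord hfree ⊢
    obtain ⟨hxL, hwL, hxw⟩ : x ∉ L ∧ w ∉ L ∧ ¬ G.Adj x w := hps (x, w) (by simp)
    rw [List.pairwise_cons, List.pairwise_cons] at hord
    obtain ⟨ox, ow, hord⟩ := hord
    have nxw : x ≠ w := fun h => by
      have := ox w (by simp)
      rw [h] at this
      omega
    have xR : x ∉ R := fun h => by have := ox x (by simp [h]); omega
    have wR : w ∉ R := fun h => by have := ow w h; omega
    have xQ : x ∉ Q := fun h => xR (by simp [hRdef, h])
    have wQ : w ∉ Q := fun h => wR (by simp [hRdef, h])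
    have hRL : ∀ v ∈ R, v ∉ L := by
      intro v hv
      rcases List.mem_append.1 hv with hv | hv
      · obtain ⟨p, hp, hv⟩ := List.mem_flatMap.1 hv
        have := hps p (by simp [hp])
        simp only [List.mem_cons, List.not_mem_nil, or_false] at hv
        rcases hv with rfl | rfl
        exacts [this.1, this.2.1]
      · exact hQL v hv
    have key := ih (fun p hp => hps p (by simp [hp])) hord
      (fun a ha b hb c hc => hfree a (by simp [ha]) b (by simp [hb]) c (by simp [hc]))
    have dxw : ∀ v, E.Adj x v → ¬ E.Adj w v := fun v h => hF.disjoint hxL hwL nxw h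
    have tri : ∀ z ∈ R, ¬ G.Adj x z → G.Adj w z := by
      intro z hz h
      exact hfree w (by simp) x (by simp) z (by simp [hz]) nxw.symm (fun e => xR (e ▸ hz))
        (fun e => wR (e ▸ hz)) (fun h => hxw h.symm) h
    have hlt : ∀ S' : Finset V, (∀ v ∈ S', v ∈ L) → ∀ a, (a ∈ R ∨ a ∈ S') → ∀ b,
        (b ∈ R ∨ b ∈ S') → E.Adj a b → r a < r x ∧ r a < r w := by
      intro S' hS' a ha b hb hab
      have m : ∀ c, (c ∈ R ∨ c ∈ S') → c ∉ L → c ∈ R := fun c hc h =>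
        hc.resolve_right fun h' => h (hS' c h')
      exact ⟨hF.lt hxL xQ hab (fun h => ox a (by simp [m a ha h]))
        (fun h => ox b (by simp [m b hb h])),
        hF.lt hwL wQ hab (fun h => ow a (m a ha h)) (fun h => ow b (m b hb h))⟩
    by_cases hZ : ∃ z ∈ S, ¬ G.Adj x z ∧ ¬ G.Adj w z
    · obtain ⟨z, hz, hmax⟩ := (S.filter fun z => ¬ G.Adj x z ∧ ¬ G.Adj w z).exists_max_image r
        (by obtain ⟨z, h1, h2⟩ := hZ; exact ⟨z, Finset.mem_filter.2 ⟨h1, h2⟩⟩)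
      obtain ⟨hzS, hxz, hwz⟩ := Finset.mem_filter.1 hz
      have hzL := hS z hzS
      obtain ⟨c, hzc, hc⟩ := hF.leaf z hzL
      have hS' : ∀ v ∈ S.erase z, v ∈ L := fun v hv => hS v (Finset.mem_of_mem_erase hv)
      obtain ⟨k, hk, hk'⟩ := key (S.erase z) hS'
      have hcard : (S.erase z).card + 1 = S.card := Finset.card_erase_add_one hzS
      have inS : ∀ a, (a ∈ R ∨ a ∈ S.erase z) → ¬ G.Adj x a → ¬ G.Adj w a → a ∈ S.erase z :=
        fun a ha h1 h2 => ha.resolve_left fun h => h2 (tri a h h1)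
      refine ⟨k + 2, hk.triple_leaf hF.radii (x := x) (w := w) (y := z) (c := c) hxw hxz hwz nxw
        (fun h => hxL (h ▸ hzL)) (fun h => hwL (h ▸ hzL)) ?_ ?_ ?_ dxw
        (fun v h h' => hxz (hF.adj_leaf hxL hzL h h'))
        (fun v h h' => hwz (hF.adj_leaf hwL hzL h h')) ?_ hzc hc ?_ ?_ ?_ ?_, ?_⟩
      · rintro (h | h)
        exacts [xR h, hxL (hS' _ h)]
      · rintro (h | h)
        exacts [wR h, hwL (hS' _ h)]
      · rintro (h | h)
        exacts [hRL _ h hzL, by simp at h]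
      · intro v a h1 h2 ha h3 h4
        exact absurd (hF.adj_leaf hwL (hS' a (inS a ha h3 h4)) h1 h2.symm) h4
      · intro a ha b hb hab
        exact hlt _ hS' a ha b hb hab
      · intro a ha b _ h1 h2 _ hab
        have haS := inS a ha h1 h2
        exact ⟨hmax a (Finset.mem_filter.2 ⟨Finset.mem_of_mem_erase haS, h1, h2⟩),
          fun h => hF.tie (hS' a haS) hzL hab hzc h⟩
      · intro a ha h1 h2
        exact hF.indep z hzL a (hS' a (inS a ha h1 h2))
      · intro v hv
        simp only [List.mem_cons, Set.mem_ofPred_eq, Finset.mem_erase] at hv ⊢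
        tauto
      · simp only [List.length_cons]
        omega
    · push Not at hZ
      obtain ⟨k, hk, hk'⟩ := key S hS
      refine ⟨k + 1, hk.pair hF.radii (x := x) (w := w) hxw nxw ?_ ?_ dxw ?_ ?_ ?_, ?_⟩
      · rintro (h | h)
        exacts [xR h, hxL (hS _ h)]
      · rintro (h | h)
        exacts [wR h, hwL (hS _ h)]
      · rintro z (h | h) h'
        exacts [tri z h h', hZ z h h']
      · intro a ha b hb hab
        exact hlt S hS a ha b hb hab
      · intro v hv
        simp only [List.mem_cons, Set.mem_ofPred_eq] at hv ⊢
        tauto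
      · simp only [List.length_cons]
        omega

theorem IsFrame.exists_resolved {V : Type*} [Finite V] {G E : SimpleGraph V} {r : V → ℝ}
    {L : Set V} {Q : List V} {ord : V → ℕ} (hF : IsFrame G E r L Q ord) (hQ : Q.Nodup)
    (hQL : ∀ v ∈ Q, v ∉ L) (hQG : ∀ u ∈ Q, ∀ v ∈ Q, u ≠ v → G.Adj u v)
    (ps : List (V × V)) (hps : ∀ p ∈ ps, p.1 ∉ L ∧ p.2 ∉ L ∧ ¬ G.Adj p.1 p.2)
    (ts : List (V × V × V)) (hts : ∀ p ∈ ts, (p.1 ∉ L ∧ p.2.1 ∉ L ∧ p.2.2 ∉ L) ∧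
      ¬ G.Adj p.1 p.2.1 ∧ ¬ G.Adj p.1 p.2.2 ∧ ¬ G.Adj p.2.1 p.2.2)
    (hord : (ts.flatMap (fun p => [p.1, p.2.1, p.2.2]) ++
      (ps.flatMap (fun p => [p.1, p.2]) ++ Q)).Pairwise fun a b => ord a < ord b)
    (hfree : ∀ a ∈ ps.flatMap (fun p => [p.1, p.2]) ++ Q,
      ∀ b ∈ ps.flatMap (fun p => [p.1, p.2]) ++ Q,
      ∀ c ∈ ps.flatMap (fun p => [p.1, p.2]) ++ Q, a ≠ b → b ≠ c → a ≠ c →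
      ¬ G.Adj a b → ¬ G.Adj b c → G.Adj a c)
    (S : Finset V) (hS : ∀ v ∈ S, v ∈ L) :
    ∃ k, Resolved G E r {v | v ∈ ts.flatMap (fun p => [p.1, p.2.1, p.2.2]) ++
      (ps.flatMap (fun p => [p.1, p.2]) ++ Q) ∨ v ∈ S} k ∧
      3 * k ≤ 6 * ts.length + 4 * ps.length + 2 * Q.length + 2 * S.card + 6 := by
  classical
  induction ts with
  | nil =>
    simpa using hF.exists_resolved_pairs hQ hQL hQG ps hps (by simpa using hord) hfree S hS
  | cons p ts ih =>
    obtain ⟨x, w, y⟩ := p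
    set R := ts.flatMap (fun p => [p.1, p.2.1, p.2.2]) ++
      (ps.flatMap (fun p => [p.1, p.2]) ++ Q) with hRdef
    have hflat : ((x, w, y) :: ts).flatMap (fun p => [p.1, p.2.1, p.2.2]) ++
        (ps.flatMap (fun p => [p.1, p.2]) ++ Q) = x :: w :: y :: R := by
      simp [hRdef]
    rw [hflat] at hord ⊢
    obtain ⟨⟨hxL, hwL, hyL⟩, hxw, hxy, hwy⟩ : (x ∉ L ∧ w ∉ L ∧ y ∉ L) ∧
      ¬ G.Adj x w ∧ ¬ G.Adj x y ∧ ¬ G.Adj w y := hts (x, w, y) (by simp)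
    rw [List.pairwise_cons, List.pairwise_cons, List.pairwise_cons] at hord
    obtain ⟨ox, ow, oy, hord⟩ := hord
    have ne : ∀ {a b}, ord a < ord b → a ≠ b := fun h e => by rw [e] at h; omega
    have xR : x ∉ R := fun h => ne (ox x (by simp [h])) rfl
    have wR : w ∉ R := fun h => ne (ow w (by simp [h])) rfl
    have yR : y ∉ R := fun h => ne (oy y h) rfl
    have nxw : x ≠ w := ne (ox w (by simp))
    have nxy : x ≠ y := ne (ox y (by simp))
    have nwy : w ≠ y := ne (ow y (by simp))
    have hQR : ∀ {v}, v ∉ R → v ∉ Q := fun h h' => h (by simp [hRdef, h'])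
    obtain ⟨k, hk, hk'⟩ := ih (fun p hp => hts p (by simp [hp])) hord
    refine ⟨k + 2, hk.triple hF.radii (x := x) (w := w) (y := y) hxw hxy hwy nxw nxy nwy ?_ ?_ ?_
      (fun v h => hF.disjoint hxL hwL nxw h) (fun v h => hF.disjoint hxL hyL nxy h)
      (fun v h => hF.disjoint hwL hyL nwy h) ?_ ?_ ?_, ?_⟩
    · rintro (h | h)
      exacts [xR h, hxL (hS _ h)]
    · rintro (h | h)
      exacts [wR h, hwL (hS _ h)]
    · rintro (h | h)
      exacts [yR h, hyL (hS _ h)]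
    · intro v z h1 h2 hz h3 h4
      by_cases hzL : z ∈ L
      · exact absurd (hF.adj_leaf hwL hzL h1 h2.symm) h4
      · have : w ≠ z := by
          rintro rfl
          rcases hz with hz | hz
          exacts [wR hz, hwL (hS _ hz)]
        exact absurd h2.symm (hF.disjoint hwL hzL this h1)
    · intro a ha b hb hab
      have m : ∀ c, (c ∈ R ∨ c ∈ S) → c ∉ L → c ∈ R := fun c hc h =>
        hc.resolve_right fun h' => h (hS c h')
      exact ⟨hF.lt hxL (hQR xR) hab (fun h => ox a (by simp [m a ha h]))
        (fun h => ox b (by simp [m b hb h])),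
        hF.lt hwL (hQR wR) hab (fun h => ow a (by simp [m a ha h]))
        (fun h => ow b (by simp [m b hb h])),
        hF.lt hyL (hQR yR) hab (fun h => oy a (m a ha h)) (fun h => oy b (m b hb h))⟩
    · intro v hv
      simp only [List.mem_cons, Set.mem_ofPred_eq] at hv ⊢
      tauto
    · simp only [List.length_cons]
      omega

/-- The properties of a minimum edge cover `E`, a disjoint union of stars, together with a maximal
independent set `L` of leaves of its stars with at least two leaves. -/
structure IsStarCover {V : Type*} (G E : SimpleGraph V) (L : Set V) : Prop where
  le : E ≤ G
  exists_adj : ∀ v, ∃ u, E.Adj v u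
  indep : ∀ u ∈ L, ∀ v ∈ L, ¬ G.Adj u v
  leaf : ∀ u ∈ L, ∃ c, c ∉ L ∧ E.Adj u c ∧ ∀ v, E.Adj u v → v = c
  mate_unique : ∀ {v a b}, v ∉ L → a ∉ L → b ∉ L → E.Adj v a → E.Adj v b → a = b
  adj_leaf : ∀ {u c b}, u ∈ L → b ∉ L → E.Adj u c → E.Adj c b → G.Adj b u
  not_adj : ∀ {u c b u' c' b'}, u ∈ L → b ∉ L → E.Adj u c → E.Adj c b →
    u' ∈ L → b' ∉ L → E.Adj u' c' → E.Adj c' b' → c ≠ c' → ¬ G.Adj c c'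

theorem SimpleGraph.exists_min_edgeCover {V : Type*} [Fintype V] (G : SimpleGraph V)
    (hG : ∀ v, ∃ u, G.Adj v u) :
    ∃ S : Finset (Sym2 V), (∀ e ∈ S, e ∈ G.edgeSet) ∧ (∀ v, ∃ e ∈ S, v ∈ e) ∧
      ∀ R ⊆ S, ∀ A : Finset (Sym2 V), (∀ e ∈ A, e ∈ G.edgeSet) →
        (∀ e ∈ R, ∀ v ∈ e, (∃ e' ∈ S, e' ∉ R ∧ v ∈ e') ∨ ∃ e' ∈ A, v ∈ e') →
        R.card ≤ A.card := by
  classical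
  let C : Finset (Finset (Sym2 V)) := Finset.univ.filter fun S =>
    (∀ e ∈ S, e ∈ G.edgeSet) ∧ ∀ v, ∃ e ∈ S, v ∈ e
  have hne : C.Nonempty := by
    refine ⟨Finset.univ.filter fun e => e ∈ G.edgeSet, ?_⟩
    simp only [C, Finset.mem_filter, Finset.mem_univ, true_and, imp_self, implies_true]
    intro v
    obtain ⟨u, hu⟩ := hG v
    exact ⟨s(v, u), hu, Sym2.mem_mk_left v u⟩
  obtain ⟨S, hS, hmin⟩ := C.exists_min_image Finset.card hne
  obtain ⟨hSG, hSc⟩ : (∀ e ∈ S, e ∈ G.edgeSet) ∧ ∀ v, ∃ e ∈ S, v ∈ e := by simpa [C] using hS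
  refine ⟨S, hSG, hSc, ?_⟩
  intro R hRS A hA hcov
  have hmem : (S \ R) ∪ A ∈ C := by
    simp only [C, Finset.mem_filter, Finset.mem_univ, true_and, Finset.mem_union,
      Finset.mem_sdiff]
    refine ⟨?_, ?_⟩
    · rintro e (h | h)
      exacts [hSG e h.1, hA e h]
    · intro v
      obtain ⟨e, he, hv⟩ := hSc v
      by_cases heR : e ∈ R
      · rcases hcov e heR v hv with ⟨e', h1, h2, h3⟩ | ⟨e', h1, h2⟩
        · exact ⟨e', Or.inl ⟨h1, h2⟩, h3⟩
        · exact ⟨e', Or.inr h1, h2⟩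
      · exact ⟨e, Or.inl ⟨he, heR⟩, hv⟩
  have h1 := hmin _ hmem
  have h2 := Finset.card_union_le (S \ R) A
  have h3 := Finset.card_sdiff_add_card_eq_card hRS
  omega

theorem SimpleGraph.exists_isStarCover {V : Type*} [Fintype V] (G : SimpleGraph V)
    (hG : ∀ v, ∃ u, G.Adj v u) : ∃ (E : SimpleGraph V) (L : Set V), IsStarCover G E L := by
  classical
  obtain ⟨S, hSG, hSc, hex⟩ := G.exists_min_edgeCover hG
  have hadj : ∀ {u v}, s(u, v) ∈ S → G.Adj u v := fun h => hSG _ h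
  have hsymm : ∀ {u v}, s(u, v) ∈ S → s(v, u) ∈ S := fun h => by rwa [Sym2.eq_swap]
  let E : SimpleGraph V :=
    { Adj := fun u v => s(u, v) ∈ S
      symm := ⟨fun _ _ h => hsymm h⟩
      loopless := ⟨fun _ h => (hadj h).ne rfl⟩ }
  -- every edge has an end of degree one
  have star : ∀ {u v u' v'}, E.Adj u v → E.Adj u u' → u' ≠ v → E.Adj v v' → v' = u := by
    intro u v u' v' h hu hne hv
    by_contra hne'
    have := hex {s(u, v)} (by simpa using h) ∅ (by simp) (by
      intro e he a ha
      rw [Finset.mem_singleton] at he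
      subst he
      left
      rcases Sym2.mem_iff.1 ha with rfl | rfl
      · exact ⟨s(a, u'), hu, by
          rw [Finset.mem_singleton, Sym2.eq_iff]
          rintro (⟨-, h'⟩ | ⟨h', -⟩)
          exacts [hne h', h.ne h'], Sym2.mem_mk_left _ _⟩
      · exact ⟨s(a, v'), hv, by
          rw [Finset.mem_singleton, Sym2.eq_iff]
          rintro (⟨h', -⟩ | ⟨-, h'⟩)
          exacts [h.ne h'.symm, hne' h'], Sym2.mem_mk_left _ _⟩)
    simp at this
  let L0 : Set V := {u | ∃ c, E.Adj u c ∧ ∃ u', u' ≠ u ∧ E.Adj c u'}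
  have L0uniq : ∀ {u c v}, u ∈ L0 → E.Adj u c → E.Adj u v → v = c := by
    rintro u c v ⟨c0, h1, u', h2, h3⟩ hc hv
    rw [star h1.symm h3 h2 hv, star h1.symm h3 h2 hc]
  have L0two : ∀ {u c}, u ∈ L0 → E.Adj u c → ∃ u', u' ≠ u ∧ E.Adj c u' := by
    rintro u c hu hc
    obtain ⟨c0, h1, u', h2, h3⟩ := hu
    have := L0uniq ⟨c0, h1, u', h2, h3⟩ hc h1
    subst this
    exact ⟨u', h2, h3⟩
  have center : ∀ {u c}, u ∈ L0 → E.Adj u c → c ∉ L0 := by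
    intro u c hu hc hcL
    obtain ⟨u', h1, h2⟩ := L0two hu hc
    exact h1 (L0uniq hcL hc.symm h2)
  have adjL0 : ∀ {u u' c c'}, u ∈ L0 → u' ∈ L0 → E.Adj u c → E.Adj u' c' → G.Adj u u' →
      c = c' ∧ ∀ v, E.Adj c v → v = u ∨ v = u' := by
    intro u u' c c' hu hu' hc hc' huu
    have n1 : c ≠ u' := fun h => center hu hc (h ▸ hu')
    have n2 : c' ≠ u := fun h => center hu' hc' (h ▸ hu)
    have n3 : u ≠ u' := huu.ne
    by_contra hcon
    have hv : ∃ v, E.Adj c v ∧ v ≠ u ∧ v ≠ u' := by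
      by_cases hcc : c = c'
      · by_contra! h
        exact hcon ⟨hcc, fun v hv => or_iff_not_imp_left.2 fun hne => h v hv hne⟩
      · obtain ⟨v, h1, h2⟩ := L0two hu hc
        refine ⟨v, h2, h1, ?_⟩
        rintro rfl
        exact hcc (L0uniq hu' hc' h2.symm)
    have hv' : ∃ v, E.Adj c' v ∧ v ≠ u ∧ v ≠ u' := by
      by_cases hcc : c = c'
      · rwa [← hcc]
      · obtain ⟨v, h1, h2⟩ := L0two hu' hc'
        refine ⟨v, h2, ?_, h1⟩
        rintro rfl
        exact hcc (L0uniq hu hc h2.symm).symm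
    obtain ⟨v, v1, v2, v3⟩ := hv
    obtain ⟨v', v1', v2', v3'⟩ := hv'
    have hne : s(u, c) ≠ s(u', c') := by
      rw [Ne, Sym2.eq_iff]
      rintro (⟨h, -⟩ | ⟨h, -⟩)
      exacts [n3 h, n2 h.symm]
    have := hex {s(u, c), s(u', c')} (by
        intro e he
        simp only [Finset.mem_insert, Finset.mem_singleton] at he
        rcases he with rfl | rfl
        exacts [hc, hc']) {s(u, u')} (by simpa using huu) (by
      intro e he a ha
      simp only [Finset.mem_insert, Finset.mem_singleton] at he ⊢
      rcases he with rfl | rfl <;> rcases Sym2.mem_iff.1 ha with rfl | rfl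
      · exact Or.inr ⟨_, rfl, Sym2.mem_mk_left _ _⟩
      · refine Or.inl ⟨s(a, v), v1, ?_, Sym2.mem_mk_left _ _⟩
        rw [Sym2.eq_iff, Sym2.eq_iff]
        rintro ((⟨h, -⟩ | ⟨-, h⟩) | (⟨h, -⟩ | ⟨-, h⟩))
        exacts [hc.ne h.symm, v2 h, n1 h, v3 h]
      · exact Or.inr ⟨_, rfl, Sym2.mem_mk_right _ _⟩
      · refine Or.inl ⟨s(a, v'), v1', ?_, Sym2.mem_mk_left _ _⟩
        rw [Sym2.eq_iff, Sym2.eq_iff]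
        rintro ((⟨h, -⟩ | ⟨-, h⟩) | (⟨h, -⟩ | ⟨-, h⟩))
        exacts [n2 h, v2' h, hc'.ne h.symm, v3' h])
    rw [Finset.card_pair hne] at this
    simp at this
  obtain ⟨L, hL, hmax⟩ : ∃ L : Finset V, ((∀ u ∈ L, u ∈ L0) ∧ ∀ u ∈ L, ∀ v ∈ L, ¬ G.Adj u v) ∧
      ∀ L' : Finset V, ((∀ u ∈ L', u ∈ L0) ∧ ∀ u ∈ L', ∀ v ∈ L', ¬ G.Adj u v) →
        L'.card ≤ L.card := by
    obtain ⟨L, hL, hmax⟩ := (Finset.univ.filter fun L : Finset V => (∀ u ∈ L, u ∈ L0) ∧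
      ∀ u ∈ L, ∀ v ∈ L, ¬ G.Adj u v).exists_max_image Finset.card
      ⟨∅, Finset.mem_filter.2 ⟨Finset.mem_univ _, by simp, by simp⟩⟩
    exact ⟨L, (Finset.mem_filter.1 hL).2, fun L' h =>
      hmax L' (Finset.mem_filter.2 ⟨Finset.mem_univ _, h⟩)⟩
  obtain ⟨hLL0, hLi⟩ := hL
  have other : ∀ {a c}, a ∈ L0 → a ∉ L → E.Adj a c →
      ∃ l ∈ L, G.Adj a l ∧ E.Adj l c ∧ ∀ v, E.Adj c v → v = a ∨ v = l := by
    intro a c ha haL hac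
    have : ∃ l ∈ L, G.Adj a l := by
      by_contra! h
      have := hmax (insert a L) ⟨by
        intro u hu
        rcases Finset.mem_insert.1 hu with rfl | hu
        exacts [ha, hLL0 u hu], by
        intro u hu v hv huv
        rcases Finset.mem_insert.1 hu with rfl | hu' <;>
          rcases Finset.mem_insert.1 hv with rfl | hv'
        exacts [huv.ne rfl, h v hv' huv, h u hu' huv.symm, hLi u hu' v hv' huv]⟩
      rw [Finset.card_insert_of_notMem haL] at this
      omega
    obtain ⟨l, hl, hal⟩ := this
    obtain ⟨c', hc', -⟩ := hLL0 l hl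
    obtain ⟨rfl, h⟩ := adjL0 ha (hLL0 l hl) hac hc' hal
    exact ⟨l, hl, hal, hc', h⟩
  have tri : ∀ {u c b}, u ∈ L → b ∉ L → E.Adj u c → E.Adj c b →
      b ∈ L0 ∧ G.Adj b u := by
    intro u c b hu hb huc hcb
    have hbL : b ∈ L0 := ⟨c, hcb.symm, u, fun h => hb (h ▸ hu), huc.symm⟩
    obtain ⟨l, hl, h1, h2, h3⟩ := other hbL hb hcb.symm
    rcases h3 u huc.symm with rfl | rfl
    · exact absurd hu hb
    · exact ⟨hbL, h1⟩
  refine ⟨E, (L : Set V), fun u v h => hadj h, ?_, hLi, ?_, ?_, fun hu hb h1 h2 =>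
    (tri hu hb h1 h2).2, ?_⟩
  · intro v
    obtain ⟨e, he, hv⟩ := hSc v
    induction e using Sym2.ind with
    | _ a b =>
      rcases Sym2.mem_iff.1 hv with rfl | rfl
      exacts [⟨b, he⟩, ⟨a, hsymm he⟩]
  · intro u hu
    obtain ⟨c, hc, -⟩ := hLL0 u hu
    exact ⟨c, fun h => center (hLL0 u hu) hc (hLL0 c h), hc, fun v hv => L0uniq (hLL0 u hu) hc hv⟩
  · intro v a b _ ha hb hva hvb
    by_contra hne
    obtain ⟨l, hl, -, -, h⟩ := other (a := a) (c := v) ⟨v, hva.symm, b, Ne.symm hne, hvb⟩ ha hva.symm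
    rcases h b hvb with rfl | rfl
    exacts [hne rfl, hb hl]
  · intro u c b u' c' b' hu hb huc hcb hu' hb' huc' hcb' hcc hadjc
    obtain ⟨hbL, hbu⟩ := tri hu hb huc hcb
    obtain ⟨hbL', hbu'⟩ := tri hu' hb' huc' hcb'
    have n1 : c ∉ L0 := center hbL hcb.symm
    have n2 : c' ∉ L0 := center hbL' hcb'.symm
    have e1 : c ≠ u' := fun h => n1 (h ▸ hLL0 u' hu')
    have e2 : c ≠ b' := fun h => n1 (h ▸ hbL')
    have e3 : c' ≠ u := fun h => n2 (h ▸ hLL0 u hu)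
    have e4 : c' ≠ b := fun h => n2 (h ▸ hbL)
    have := hex {s(c, b), s(c, u), s(c', b'), s(c', u')} (by
        intro e he
        simp only [Finset.mem_insert, Finset.mem_singleton] at he
        rcases he with rfl | rfl | rfl | rfl
        exacts [hcb, huc.symm, hcb', huc'.symm]) {s(b, u), s(b', u'), s(c, c')} (by
        intro e he
        simp only [Finset.mem_insert, Finset.mem_singleton] at he
        rcases he with rfl | rfl | rfl
        exacts [hbu, hbu', hadjc]) (by
      intro e he a ha
      right
      simp only [Finset.mem_insert, Finset.mem_singleton] at he ⊢
      have m1 : ∃ e', (e' = s(b, u) ∨ e' = s(b', u') ∨ e' = s(c, c')) ∧ c ∈ e' :=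
        ⟨_, Or.inr (Or.inr rfl), Sym2.mem_mk_left _ _⟩
      have m2 : ∃ e', (e' = s(b, u) ∨ e' = s(b', u') ∨ e' = s(c, c')) ∧ c' ∈ e' :=
        ⟨_, Or.inr (Or.inr rfl), Sym2.mem_mk_right _ _⟩
      rcases he with rfl | rfl | rfl | rfl <;> rcases Sym2.mem_iff.1 ha with rfl | rfl
      · exact m1
      · exact ⟨_, Or.inl rfl, Sym2.mem_mk_left _ _⟩
      · exact m1
      · exact ⟨_, Or.inl rfl, Sym2.mem_mk_right _ _⟩
      · exact m2
      · exact ⟨_, Or.inr (Or.inl rfl), Sym2.mem_mk_left _ _⟩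
      · exact m2
      · exact ⟨_, Or.inr (Or.inl rfl), Sym2.mem_mk_right _ _⟩)
    have hcard : Finset.card {s(c, b), s(c, u), s(c', b'), s(c', u')} = 4 := by
      rw [Finset.card_insert_of_notMem, Finset.card_insert_of_notMem, Finset.card_pair]
      · rw [Ne, Sym2.eq_iff]
        rintro (⟨-, h⟩ | ⟨h, -⟩)
        exacts [hbu'.ne h, huc'.ne h.symm]
      · simp only [Finset.mem_insert, Finset.mem_singleton, Sym2.eq_iff]
        rintro ((⟨h, -⟩ | ⟨h, -⟩) | (⟨h, -⟩ | ⟨h, -⟩))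
        exacts [hcc h, e2 h, hcc h, e1 h]
      · simp only [Finset.mem_insert, Finset.mem_singleton, Sym2.eq_iff]
        rintro ((⟨-, h⟩ | ⟨h, -⟩) | (⟨h, -⟩ | ⟨h, -⟩) | (⟨h, -⟩ | ⟨h, -⟩))
        exacts [hbu.ne h, huc.ne h.symm, hcc h, e2 h, hcc h, e1 h]
    have h3 : Finset.card {s(b, u), s(b', u'), s(c, c')} ≤ 3 := Finset.card_le_three
    omega

theorem SimpleGraph.exists_triangle_packing {V : Type*} (G : SimpleGraph V) (Y : Finset V) :
    ∃ (ts : List (V × V × V)) (R : Finset V),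
      (ts.flatMap fun p => [p.1, p.2.1, p.2.2]).Nodup ∧ R ⊆ Y ∧
      (∀ v, v ∈ ts.flatMap (fun p => [p.1, p.2.1, p.2.2]) ↔ v ∈ Y ∧ v ∉ R) ∧
      (∀ p ∈ ts, ¬ G.Adj p.1 p.2.1 ∧ ¬ G.Adj p.1 p.2.2 ∧ ¬ G.Adj p.2.1 p.2.2) ∧
      ∀ a ∈ R, ∀ b ∈ R, ∀ c ∈ R, a ≠ b → b ≠ c → a ≠ c → ¬ G.Adj a b → ¬ G.Adj b c →
        G.Adj a c := by
  classical
  induction Y using Finset.strongInduction with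
  | H Y ih =>
    by_cases h : ∃ a ∈ Y, ∃ b ∈ Y, ∃ c ∈ Y, a ≠ b ∧ b ≠ c ∧ a ≠ c ∧ ¬ G.Adj a b ∧ ¬ G.Adj b c ∧
        ¬ G.Adj a c
    · obtain ⟨a, ha, b, hb, c, hc, n1, n2, n3, h1, h2, h3⟩ := h
      obtain ⟨ts, R, hnd, hRY, hmem, hts, hR⟩ := ih (Y \ {a, b, c})
        (Finset.sdiff_ssubset (by simp [Finset.insert_subset_iff, ha, hb, hc]) (by simp))
      have hn : ∀ x ∈ ({a, b, c} : Finset V),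
          x ∉ ts.flatMap (fun p => [p.1, p.2.1, p.2.2]) ∧ x ∉ R := fun x hx =>
        ⟨fun h => (Finset.mem_sdiff.1 ((hmem x).1 h).1).2 hx,
          fun h => (Finset.mem_sdiff.1 (hRY h)).2 hx⟩
      have ha' := hn a (by simp)
      have hb' := hn b (by simp)
      have hc' := hn c (by simp)
      refine ⟨(a, b, c) :: ts, R, ?_, hRY.trans Finset.sdiff_subset, ?_, ?_, hR⟩
      · have : ((a, b, c) :: ts).flatMap (fun p => [p.1, p.2.1, p.2.2]) =
            a :: b :: c :: ts.flatMap (fun p => [p.1, p.2.1, p.2.2]) := by simp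
        rw [this, List.nodup_cons, List.nodup_cons, List.nodup_cons]
        refine ⟨?_, ?_, hc'.1, hnd⟩
        · rw [List.mem_cons, List.mem_cons]
          rintro (h | h | h)
          exacts [n1 h, n3 h, ha'.1 h]
        · rw [List.mem_cons]
          rintro (h | h)
          exacts [n2 h, hb'.1 h]
      · intro v
        have := hmem v
        rw [List.flatMap_cons, List.mem_append, this]
        simp only [List.mem_cons, List.not_mem_nil, or_false, Finset.mem_sdiff,
          Finset.mem_insert, Finset.mem_singleton]
        constructor
        · rintro ((rfl | rfl | rfl) | h)
          exacts [⟨ha, ha'.2⟩, ⟨hb, hb'.2⟩, ⟨hc, hc'.2⟩, ⟨h.1.1, h.2⟩]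
        · rintro ⟨h1, h2⟩
          by_cases h : v = a ∨ v = b ∨ v = c
          exacts [Or.inl h, Or.inr ⟨⟨h1, h⟩, h2⟩]
      · intro p hp
        rcases List.mem_cons.1 hp with rfl | hp
        exacts [⟨h1, h3, h2⟩, hts p hp]
    · refine ⟨[], Y, by simp, subset_rfl, by simp, by simp, ?_⟩
      intro a ha b hb c hc n1 n2 n3 h1 h2
      by_contra h3
      exact h ⟨a, ha, b, hb, c, hc, n1, n2, n3, h1, h2, h3⟩

theorem SimpleGraph.exists_pair_packing {V : Type*} (G : SimpleGraph V) (Y : Finset V) :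
    ∃ (ps : List (V × V)) (Q : List V), (ps.flatMap (fun p => [p.1, p.2]) ++ Q).Nodup ∧
      (∀ v, v ∈ ps.flatMap (fun p => [p.1, p.2]) ++ Q ↔ v ∈ Y) ∧
      (∀ p ∈ ps, ¬ G.Adj p.1 p.2) ∧ ∀ u ∈ Q, ∀ v ∈ Q, u ≠ v → G.Adj u v := by
  classical
  induction Y using Finset.strongInduction with
  | H Y ih =>
    by_cases h : ∃ a ∈ Y, ∃ b ∈ Y, a ≠ b ∧ ¬ G.Adj a b
    · obtain ⟨a, ha, b, hb, n1, h1⟩ := h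
      obtain ⟨ps, Q, hnd, hmem, hps, hQ⟩ := ih (Y \ {a, b})
        (Finset.sdiff_ssubset (by simp [Finset.insert_subset_iff, ha, hb]) (by simp))
      have hn : ∀ x ∈ ({a, b} : Finset V),
          x ∉ ps.flatMap (fun p => [p.1, p.2]) ++ Q := fun x hx h =>
        (Finset.mem_sdiff.1 ((hmem x).1 h)).2 hx
      have hflat : ((a, b) :: ps).flatMap (fun p => [p.1, p.2]) ++ Q =
          a :: b :: (ps.flatMap (fun p => [p.1, p.2]) ++ Q) := by simp
      refine ⟨(a, b) :: ps, Q, ?_, ?_, ?_, hQ⟩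
      · rw [hflat, List.nodup_cons, List.nodup_cons]
        refine ⟨?_, hn b (by simp), hnd⟩
        rw [List.mem_cons]
        rintro (h | h)
        exacts [n1 h, hn a (by simp) h]
      · intro v
        rw [hflat, List.mem_cons, List.mem_cons, hmem v]
        simp only [Finset.mem_sdiff, Finset.mem_insert, Finset.mem_singleton]
        constructor
        · rintro (rfl | rfl | h)
          exacts [ha, hb, h.1]
        · intro h
          by_cases h1 : v = a
          · exact Or.inl h1
          by_cases h2 : v = b
          · exact Or.inr (Or.inl h2)
          exact Or.inr (Or.inr ⟨h, by simp [h1, h2]⟩)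
      · intro p hp
        rcases List.mem_cons.1 hp with rfl | hp
        exacts [h1, hps p hp]
    · refine ⟨[], Y.toList, by simpa using Y.nodup_toList, by simp, by simp, ?_⟩
      intro u hu v hv hne
      by_contra h1
      exact h ⟨u, by simpa using hu, v, by simpa using hv, hne, h1⟩

theorem IsStarCover.exists_mate {V : Type*} {G E : SimpleGraph V} {L : Set V}
    (h : IsStarCover G E L) : ∃ μ : V → V, ∀ y, y ∉ L →
      μ y ∉ L ∧ (μ y = y ∨ E.Adj y (μ y)) ∧ ∀ m, m ∉ L → E.Adj y m → m = μ y := by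
  classical
  have : ∀ y, ∃ m, y ∉ L → m ∉ L ∧ (m = y ∨ E.Adj y m) ∧ ∀ m', m' ∉ L → E.Adj y m' → m' = m := by
    intro y
    by_cases hm : ∃ m, m ∉ L ∧ E.Adj y m
    · obtain ⟨m, hm, hym⟩ := hm
      exact ⟨m, fun hy => ⟨hm, Or.inr hym, fun m' hm' h' => h.mate_unique hy hm' hm h' hym⟩⟩
    · push Not at hm
      exact ⟨y, fun hy => ⟨hy, Or.inl rfl, fun m' hm' h' => absurd h' (hm m' hm')⟩⟩
  choose μ hμ using this
  exact ⟨μ, hμ⟩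

theorem IsStarCover.exists_isFrame {V : Type*} {G E₀ : SimpleGraph V} {L : Set V}
    (h : IsStarCover G E₀ L) (Q : List V) (hQL : ∀ v ∈ Q, v ∉ L)
    (hQG : ∀ u ∈ Q, ∀ v ∈ Q, u ≠ v → G.Adj u v) (ord : V → ℕ)
    (hord : ∀ u, u ∉ L → ∀ v, v ∉ L → ord u = ord v → u = v) :
    ∃ (E : SimpleGraph V) (r : V → ℝ), IsFrame G E r L Q ord ∧ ∀ v, ∃ u, E.Adj v u := by
  classical
  obtain ⟨μ, hμ⟩ := h.exists_mate
  have μL : ∀ {y}, y ∉ L → μ y ∉ L := fun hy => (hμ _ hy).1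
  have μadj : ∀ {y}, y ∉ L → μ y ≠ y → E₀.Adj y (μ y) := fun hy hne =>
    (hμ _ hy).2.1.resolve_left hne
  have μeq : ∀ {y m}, y ∉ L → m ∉ L → E₀.Adj y m → m = μ y := fun hy hm hym =>
    (hμ _ hy).2.2 _ hm hym
  have μμ : ∀ {y}, y ∉ L → μ (μ y) = y := by
    intro y hy
    by_cases hne : μ y = y
    · rw [hne, hne]
    · exact (μeq (μL hy) hy (μadj hy hne).symm).symm
  have : ∀ u, ∃ c, u ∈ L → c ∉ L ∧ E₀.Adj u c ∧ ∀ v, E₀.Adj u v → v = c := by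
    intro u
    by_cases hu : u ∈ L
    · obtain ⟨c, hc⟩ := h.leaf u hu
      exact ⟨c, fun _ => hc⟩
    · exact ⟨u, fun hu' => absurd hu' hu⟩
  choose cen hcen using this
  -- the earlier one of a vertex outside `L` and its mate
  let first : V → V := fun y => if ord (μ y) < ord y then μ y else y
  have first_or : ∀ y, first y = y ∨ first y = μ y := by
    intro y
    by_cases hy : ord (μ y) < ord y <;> simp [first, hy]
  have firstL : ∀ {y}, y ∉ L → first y ∉ L := by
    intro y hy
    rcases first_or y with h | h <;> rw [h]
    exacts [hy, μL hy]
  have first_le : ∀ y, ord (first y) ≤ ord y := by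
    intro y
    by_cases hy : ord (μ y) < ord y
    · simp only [first, if_pos hy]; exact hy.le
    · simp only [first, if_neg hy]; exact le_rfl
  have first_mu : ∀ {y}, y ∉ L → first (μ y) = first y := by
    intro y hy
    simp only [first, μμ hy]
    rcases lt_trichotomy (ord (μ y)) (ord y) with h | h | h
    · rw [if_neg h.le.not_gt, if_pos h]
    · have := hord _ (μL hy) _ hy h
      simp [this]
    · rw [if_pos h, if_neg h.le.not_gt]
  have first_first : ∀ {y}, y ∉ L → first (first y) = first y := by
    intro y hy
    rcases first_or y with h | h
    · rw [h, h]
    · rw [h, first_mu hy, h]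
  let rep : V → V := fun v => if v ∈ L then first (cen v) else first v
  have repL : ∀ {v}, v ∈ L → rep v = first (cen v) := fun hv => by simp [rep, hv]
  have repY : ∀ {v}, v ∉ L → rep v = first v := fun hv => by simp [rep, hv]
  have rep_not : ∀ v, rep v ∉ L := by
    intro v
    by_cases hv : v ∈ L
    · rw [repL hv]; exact firstL (hcen v hv).1
    · rw [repY hv]; exact firstL hv
  have rep_rep : ∀ v, rep (rep v) = rep v := by
    intro v
    rw [repY (rep_not v)]
    by_cases hv : v ∈ L
    · rw [repL hv]; exact first_first (hcen v hv).1
    · rw [repY hv]; exact first_first hv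
  let E : SimpleGraph V :=
    { Adj := fun a b => (a ∉ L ∧ b ∉ L ∧ E₀.Adj a b) ∨ (a ∈ L ∧ b = rep a) ∨ (b ∈ L ∧ a = rep b)
      symm := ⟨fun a b h => by
        rcases h with ⟨h1, h2, h3⟩ | h | h
        exacts [Or.inl ⟨h2, h1, h3.symm⟩, Or.inr (Or.inr h), Or.inr (Or.inl h)]⟩
      loopless := ⟨fun a h => by
        rcases h with ⟨-, -, h3⟩ | ⟨h1, h2⟩ | ⟨h1, h2⟩
        exacts [h3.ne rfl, rep_not a (h2 ▸ h1), rep_not a (h2 ▸ h1)]⟩ }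
  have E_leaf : ∀ {u v}, u ∈ L → E.Adj u v → v = rep u := by
    rintro u v hu (⟨h1, -⟩ | ⟨-, h2⟩ | ⟨-, h2⟩)
    exacts [absurd hu h1, h2, absurd (h2 ▸ hu) (rep_not v)]
  have E_mate : ∀ {u v}, u ∉ L → v ∉ L → E.Adj u v → E₀.Adj u v := by
    rintro u v hu hv (⟨-, -, h2⟩ | ⟨h1, -⟩ | ⟨h1, -⟩)
    exacts [h2, absurd h1 hu, absurd h1 hv]
  have E_rep : ∀ {a b}, E.Adj a b → rep a = rep b := by
    rintro a b (⟨h1, h2, h3⟩ | ⟨-, rfl⟩ | ⟨-, rfl⟩)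
    · rw [repY h1, repY h2, μeq h1 h2 h3, first_mu h1]
    · exact (rep_rep a).symm
    · exact rep_rep b
  have rep_adj : ∀ {u}, u ∈ L → G.Adj u (rep u) := by
    intro u hu
    obtain ⟨hc, huc, -⟩ := hcen u hu
    rw [repL hu]
    rcases first_or (cen u) with h' | h'
    · rw [h']; exact h.le huc
    · by_cases hne : μ (cen u) = cen u
      · rw [h', hne]; exact h.le huc
      · rw [h']; exact (h.adj_leaf hu (μL hc) huc (μadj hc hne)).symm
  have E_le : ∀ {a b}, E.Adj a b → G.Adj a b := by
    rintro a b (⟨-, -, h3⟩ | ⟨h1, rfl⟩ | ⟨h1, rfl⟩)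
    exacts [h.le h3, rep_adj h1, (rep_adj h1).symm]
  let low : V → Prop := fun y => y ∈ Q ∧ μ y ∈ Q ∧ μ y ≠ y
  let r : V → ℝ := fun v => if low (rep v) then 1 else 1 + 1 / (10 * ((ord (rep v) : ℝ) + 1))
  have r_low : ∀ {v}, low (rep v) → r v = 1 := fun hv => by simp only [r, if_pos hv]
  have r_high : ∀ {v}, ¬ low (rep v) → r v = 1 + 1 / (10 * ((ord (rep v) : ℝ) + 1)) :=
    fun hv => by simp only [r, if_neg hv]
  have pos : ∀ n : ℕ, (0 : ℝ) < 1 / (10 * ((n : ℝ) + 1)) := fun n => by positivity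
  have anti : ∀ m n : ℕ, m < n →
      1 / (10 * ((n : ℝ) + 1)) < 1 / (10 * ((m : ℝ) + 1)) := by
    intro m n hmn
    have : (m : ℝ) < n := by exact_mod_cast hmn
    exact one_div_lt_one_div_of_lt (by positivity) (by linarith)
  have le_high : ∀ v, r v ≤ 1 + 1 / (10 * ((ord (rep v) : ℝ) + 1)) := by
    intro v
    by_cases hv : low (rep v)
    · rw [r_low hv]; linarith [pos (ord (rep v))]
    · rw [r_high hv]
  refine ⟨E, r, ⟨⟨?_, ?_, ?_, E_le⟩, h.indep, ?_, ?_, ?_, ?_, ?_, ?_⟩, ?_⟩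
  · intro v
    by_cases hv : low (rep v)
    · rw [r_low hv]
    · rw [r_high hv]; linarith [pos (ord (rep v))]
  · intro v
    have h1 := le_high v
    have h2 : 1 / (10 * ((ord (rep v) : ℝ) + 1)) ≤ 1 / 10 :=
      one_div_le_one_div_of_le (by norm_num)
        (by linarith [(Nat.cast_nonneg (ord (rep v)) : (0 : ℝ) ≤ _)])
    linarith
  · intro u v huv
    simp only [r, E_rep huv]
  · intro y y' v hy hy' hne h1 h2
    by_cases hv : v ∈ L
    · exact hne ((E_leaf hv h1.symm).trans (E_leaf hv h2.symm).symm)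
    · exact hne (h.mate_unique hv hy hy' (E_mate hv hy h1.symm) (E_mate hv hy' h2.symm))
  · intro y u v hy hu h1 h2
    obtain ⟨hc, huc, -⟩ := hcen u hu
    have hv := E_leaf hu h2
    have hvL : v ∉ L := hv ▸ rep_not u
    have h3 := E_mate hy hvL h1
    rw [repL hu] at hv
    rcases first_or (cen u) with h' | h'
    · rw [hv, h'] at h3
      exact h.adj_leaf hu hy huc h3.symm
    · have : y = cen u := by
        rw [μeq hvL hy h3.symm, hv, h', μμ hc]
      rw [this]
      exact (h.le huc).symm
  · intro u hu
    exact ⟨rep u, Or.inr (Or.inl ⟨hu, rfl⟩), fun v hv => E_leaf hu hv⟩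
  · intro a b z c ha hz hab hzc hr
    rw [E_leaf ha hab, E_leaf hz hzc]
    by_cases h1 : low (rep a) <;> by_cases h2 : low (rep z)
    · obtain ⟨ca, hca, -⟩ := hcen a ha
      obtain ⟨cz, hcz, -⟩ := hcen z hz
      have cenQ : ∀ {u}, u ∈ L → low (rep u) → cen u ∈ Q ∧ μ (cen u) ≠ cen u := by
        intro u hu hlow
        obtain ⟨hc, -, -⟩ := hcen u hu
        rw [repL hu] at hlow
        rcases first_or (cen u) with h' | h' <;> rw [h'] at hlow
        · exact ⟨hlow.1, hlow.2.2⟩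
        · have := hlow.2
          rw [μμ hc] at this
          exact ⟨this.1, this.2.symm⟩
      obtain ⟨qa, ma⟩ := cenQ ha h1
      obtain ⟨qz, mz⟩ := cenQ hz h2
      by_cases hcc : cen a = cen z
      · rw [repL ha, repL hz, hcc]
      · exact absurd (hQG _ qa _ qz hcc) (h.not_adj ha (μL ca) hca (μadj ca ma) hz (μL cz) hcz
          (μadj cz mz) hcc)
    · rw [r_low h1, r_high h2] at hr
      linarith [pos (ord (rep z))]
    · rw [r_high h1, r_low h2] at hr
      linarith [pos (ord (rep a))]
    · rw [r_high h1, r_high h2] at hr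
      refine hord _ (rep_not a) _ (rep_not z) ?_
      rcases lt_trichotomy (ord (rep a)) (ord (rep z)) with h | h | h
      · linarith [anti _ _ h]
      · exact h
      · linarith [anti _ _ h]
  · intro t a b ht htQ hab h1 h2
    have hlt : ord t < ord (rep a) := by
      by_cases ha : a ∈ L
      · have hb := E_leaf ha hab
        rw [← hb]
        exact h2 (hb ▸ rep_not a)
      · by_cases hb : b ∈ L
        · have := E_leaf hb hab.symm
          rw [this, rep_rep, ← this]
          exact h1 ha
        · rw [repY ha]
          rcases first_or a with h' | h' <;> rw [h']
          · exact h1 ha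
          · rw [← μeq ha hb (E_mate ha hb hab)]
            exact h2 hb
    have hhigh : ¬ low (rep t) := by
      rw [repY ht]
      rcases first_or t with h' | h' <;> rw [h']
      · exact fun hl => htQ hl.1
      · intro hl
        have := hl.2.1
        rw [μμ ht] at this
        exact htQ this
    have hle : ord (rep t) ≤ ord t := by
      rw [repY ht]
      exact first_le t
    rw [r_high hhigh]
    linarith [le_high a, anti _ _ (hle.trans_lt hlt)]
  · intro a ha b hb hab
    have aL := hQL a ha
    have bL := hQL b hb
    have e := μeq aL bL (E_mate aL bL hab)
    apply r_low
    rw [repY aL]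
    rcases first_or a with h' | h' <;> rw [h']
    · exact ⟨ha, e ▸ hb, e ▸ hab.ne'⟩
    · refine ⟨e ▸ hb, ?_, ?_⟩ <;> rw [μμ aL]
      · exact ha
      · exact e ▸ hab.ne
  · intro v
    by_cases hv : v ∈ L
    · exact ⟨rep v, Or.inr (Or.inl ⟨hv, rfl⟩)⟩
    · by_cases hne : μ v = v
      · obtain ⟨u, hu⟩ := h.exists_adj v
        by_cases huL : u ∈ L
        · refine ⟨u, Or.inr (Or.inr ⟨huL, ?_⟩)⟩
          rw [repL huL, ← (hcen u huL).2.2 v hu.symm]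
          rcases first_or v with h' | h' <;> rw [h']
          exact hne.symm
        · have := μeq hv huL hu
          rw [hne] at this
          exact absurd this hu.ne'
      · exact ⟨μ v, Or.inl ⟨hv, μL hv, μadj hv hne⟩⟩

theorem SimpleGraph.exists_sigRealizable {V : Type*} [Fintype V] [Nontrivial V]
    (G : SimpleGraph V) (hG : ∀ v, ∃ u, G.Adj v u) :
    ∃ k, 3 * k ≤ 2 * Fintype.card V + 6 ∧ SIGRealizable G k := by
  classical
  obtain ⟨E₀, L, hL⟩ := G.exists_isStarCover hG
  obtain ⟨ts, R, tnd, -, tmem, htG, hfree⟩ := G.exists_triangle_packing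
    (Finset.univ.filter fun v => v ∉ L)
  obtain ⟨ps, Q, pnd, pmem, hpG, hQG⟩ := G.exists_pair_packing
    (R.filter fun v => v ∉ L)
  set P := ps.flatMap (fun p => [p.1, p.2]) ++ Q with hP
  set T := ts.flatMap (fun p => [p.1, p.2.1, p.2.2]) with hT
  have hnd : (T ++ P).Nodup := by
    rw [List.nodup_append]
    refine ⟨tnd, pnd, ?_⟩
    rintro a ha b hb rfl
    exact ((tmem a).1 ha).2 (Finset.mem_filter.1 ((pmem a).1 hb)).1
  have hmem : ∀ v, v ∈ T ++ P ↔ v ∉ L := by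
    intro v
    rw [List.mem_append, tmem, pmem]
    simp only [Finset.mem_filter, Finset.mem_univ, true_and]
    tauto
  have hord : (T ++ P).Pairwise fun a b => (T ++ P).idxOf a < (T ++ P).idxOf b := by
    rw [List.pairwise_iff_getElem]
    intro i j hi hj hij
    rwa [hnd.idxOf_getElem, hnd.idxOf_getElem]
  have hQL : ∀ v ∈ Q, v ∉ L := fun v hv => (hmem v).1 (by simp [hP, hv])
  obtain ⟨E, r, hF, hE⟩ := hL.exists_isFrame Q hQL hQG (fun v => (T ++ P).idxOf v)
    (fun u hu v _ he => (List.idxOf_inj ((hmem u).2 hu)).1 he)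
  obtain ⟨k, hk, hk'⟩ := hF.exists_resolved (List.nodup_append.1 pnd).2.1 hQL hQG ps
    (fun p hp => ⟨(hmem _).1 (List.mem_append_right _ (List.mem_append_left _
      (List.mem_flatMap.2 ⟨p, hp, by simp⟩))), (hmem _).1 (List.mem_append_right _
      (List.mem_append_left _ (List.mem_flatMap.2 ⟨p, hp, by simp⟩))), hpG p hp⟩) ts
    (fun p hp => ⟨⟨(hmem _).1 (List.mem_append_left _ (List.mem_flatMap.2 ⟨p, hp, by simp⟩)),
      (hmem _).1 (List.mem_append_left _ (List.mem_flatMap.2 ⟨p, hp, by simp⟩)),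
      (hmem _).1 (List.mem_append_left _ (List.mem_flatMap.2 ⟨p, hp, by simp⟩))⟩, htG p hp⟩)
    hord (fun a ha b hb c hc => hfree a (Finset.mem_filter.1 ((pmem a).1 ha)).1 b
      (Finset.mem_filter.1 ((pmem b).1 hb)).1 c (Finset.mem_filter.1 ((pmem c).1 hc)).1)
    (Finset.univ.filter fun v => v ∈ L) (by simp)
  refine ⟨k, ?_, Resolved.realizable (fun v => by linarith [hF.radii.one_le v]) hE ?_⟩
  · have h1 : (T ++ P).length + (Finset.univ.filter fun v => v ∈ L).card = Fintype.card V := by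
      rw [← List.toFinset_card_of_nodup hnd]
      have : (T ++ P).toFinset = Finset.univ.filter fun v => ¬ v ∈ L := by
        ext v
        rw [List.mem_toFinset, hmem]
        simp
      rw [this, add_comm, Finset.card_filter_add_card_filter_not, Finset.card_univ]
    have h2 : T.length = 3 * ts.length := by
      simp [hT, List.length_flatMap, mul_comm]
    have h3 : P.length = 2 * ps.length + Q.length := by
      simp [hP, List.length_flatMap, mul_comm]
    rw [List.length_append, h2, h3] at h1
    omega
  · convert hk using 1
    ext v
    have := hmem v
    simp only [Set.mem_univ, true_iff]
    by_cases hv : v ∈ L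
    · exact Or.inr (by simp [hv])
    · exact Or.inl (this.2 hv)

theorem theorem1p3 {V : Type*} [Fintype V] [Nonempty V] (G : SimpleGraph V)
    (hG : ∀ v : V, ¬ G.IsIsolated v) :
    (∃ d : ℕ, d ≤ ⌊(2 * (Fintype.card V : ℝ)) / 3⌋₊ + 2 ∧ SIGRealizable G d) ∧
    sigDim G ≤ ⌊(2 * (Fintype.card V : ℝ)) / 3⌋₊ + 2 ∧
    (¬ 3 ∣ Fintype.card V → sigDim G ≤ ⌈(2 * (Fintype.card V : ℝ)) / 3⌉₊ + 1) := by
  have hadj : ∀ v, ∃ u, G.Adj v u := by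
    intro v
    by_contra! h
    exact hG v h
  obtain ⟨v⟩ := ‹Nonempty V›
  obtain ⟨u, hu⟩ := hadj v
  have : Nontrivial V := ⟨v, u, hu.ne⟩
  obtain ⟨k, hk, hr⟩ := G.exists_sigRealizable hadj
  have hfloor : ⌊(2 * (Fintype.card V : ℝ)) / 3⌋₊ = 2 * Fintype.card V / 3 := by
    rw [← Nat.floor_div_eq_div (K := ℝ)]
    push_cast
    rfl
  have hk2 : k ≤ 2 * Fintype.card V / 3 + 2 := by omega
  have hdim : sigDim G ≤ k := Nat.sInf_le hr
  rw [hfloor]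
  refine ⟨⟨k, hk2, hr⟩, hdim.trans hk2, fun h3 => ?_⟩
  have hceil : 2 * Fintype.card V / 3 < ⌈(2 * (Fintype.card V : ℝ)) / 3⌉₊ := by
    rw [Nat.lt_ceil, lt_div_iff₀ (by norm_num)]
    have : 2 * Fintype.card V / 3 * 3 < 2 * Fintype.card V := by omega
    exact_mod_cast this
  omega
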